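/- Let $n\ge 1$ and let $A=(a_{i,j})\in\mathbb R^{n\times n}$ be an irreducible L-matrix with unit diagonal: $a_{i,i}=1$, $a_{i,j}\le 0$ for $i\ne j$, and no simultaneous permutation of rows and columns brings $A$ to the form $\begin{pmatrix}B_{1,1}&B_{1,2}\\0&B_{2,2}\end{pmatrix}$ with square diagonal blocks of sizes $r$ and $n-r$, $1\le r\le n-1$. Let $Q_1=(q_{i,j})\in\mathbb R^{n\times n}$ satisfy $q_{i,i}=0$, $q_{i,j}\ge 0$ for $i\neq j$, and $\sum_{i\ne j}q_{i,j}\ne 0$, and put $P_1=I+Q_1$. Let $0<\omega\le 1$ and $0\le\gamma\le 1$. For a matrix $B=D_B-L_B-U_B$, with $D_B$ diagonal and $L_B$, $U_B$ strictly lower and strictly upper triangular, the AOR iteration matrix is $(D_B-\gamma L_B)^{-1}[(1-\omega)D_B+(\omega-\gamma)L_B+\omega U_B]$. Denote it by $\mathscr L_{\gamma,\omega}$ for $B=A$ and by $\mathscr L^{(1)}_{\gamma,\omega}$ for $B=P_1A$, and let $\rho$ be the spectral radius. Write $A=I-L-U$ in this way, let $Q^{(l)}$, $Q^{(u)}$ be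 the strictly lower and strictly upper triangular parts of $Q_1$, let $E_1,F_1$ (respectively $E_2,F_2$) be the diagonal and the strictly lower triangular parts of $Q^{(l)}U$ (respectively $Q^{(u)}L$), and put $\Delta=(\delta_{i,j})=E_1+E_2+F_1+F_2+Q^{(u)}U$. Suppose that $P_1A$ is an L-matrix (nonpositive off-diagonal entries, positive diagonal entries) and that one of the following conditions holds. (i) $\gamma<1$ and $P_1A$ is irreducible. (ii) $\gamma=1$, $P_1A$ is irreducible, and one of the following holds: ($ii_1$) $\delta_{i,j}>0$ for some $i,j\in\{1,\dots,n\}$; ($ii_2$) $q_{n,1}>0$; ($ii_3$) $q_{k,k+1}>0$ for some $k\in\{1,\dots,n-1\}$; ($ii_4$) $q_{i,j}a_{j,i}<0$ for some $i,j\in\{1,\dots,n\}$; ($ii_5$) $q_{i,n}a_{n,j}<0$ for some $i\in\{1,\dots,n-1\}$, $j\in\{1,\dots,i\}$; ($ii_6$) $q_{i,j}a_{j,1}<0$ for some $i\in\{1,\dots,n-1\}$, $j\in\{i+1,\dots,n\}$; ($ii_7$) $q_{i,j}a_{j,j+1}<0$ for some $i\in\{1,\dots,n\}$, $j\in\{1,\dots,n-1\}$;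 ($ii_8$) $q_{i,1}a_{1,j}<0$ for some $i\in\{2,\dots,n\}$, $j\in\{2,\dots,i\}$; ($ii_9$) $a_{n,1}<0$ and $a_{k,k+1}<0$ for all $k\in\{1,\dots,n-1\}$. (iii) $\gamma<1$ and for each $i\in\{1,\dots,n-1\}$ there is $j\in\{1,\dots,n\}$ with $q_{i,j}>0$. (iv) $\gamma=1$; for each $i\in\{2,\dots,n-1\}$ one of ($iv_1$)–($iv_7$) holds: ($iv_1$) $\delta_{i,j}>0$ for some $j\in\{1,\dots,n\}$; ($iv_2$) $q_{i,i+1}>0$; ($iv_3$) $q_{i,j}a_{j,i}<0$ for some $j\in\{1,\dots,n\}$; ($iv_4$) $q_{i,n}a_{n,j}<0$ for some $j\in\{1,\dots,i\}$; ($iv_5$) $q_{i,j}a_{j,1}<0$ for some $j\in\{i+1,\dots,n\}$; ($iv_6$) $q_{i,j}a_{j,j+1}<0$ for some $j\in\{1,\dots,n-1\}$; ($iv_7$) $q_{i,1}a_{1,j}<0$ for some $j\in\{2,\dots,i\}$; and, in addition, one of ($iv^a$)–($iv^e$) holds: ($iv^a$) $q_{n,k}a_{k,j}<0$ for some $j\in\{2,\dots,n\}$,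 $k\in\{1,\dots,j-1\}$; ($iv^b$) $q_{n,1}>0$; ($iv^c$) $a_{n,j}+q_{n,j}+\sum_{1\le k\le n-1,\,k\ne j}q_{n,k}a_{k,j}<0$ for some $j\in\{2,\dots,n-1\}$; ($iv^d$) one of ($iv_1$)–($iv_6$) holds for $i=1$, and $a_{n,1}+q_{n,1}+\sum_{k=2}^{n-1}q_{n,k}a_{k,1}<0$; ($iv^e$) one of ($iv_1$)–($iv_6$) holds for $i=1$, and $a_{n,1}<0$. Then one of the following mutually exclusive relations holds: $\rho(\mathscr L^{(1)}_{\gamma,\omega})<\rho(\mathscr L_{\gamma,\omega})<1$; or $\rho(\mathscr L^{(1)}_{\gamma,\omega})=\rho(\mathscr L_{\gamma,\omega})=1$; or $\rho(\mathscr L^{(1)}_{\gamma,\omega})>\rho(\mathscr L_{\gamma,\omega})>1$. -/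

import Mathlib

open scoped ENNReal

namespace PrecondAOR

noncomputable section

variable {n : ℕ}

/-- Z-matrix: all off-diagonal entries are nonpositive. -/
def IsZMatrix (B : Matrix (Fin n) (Fin n) ℝ) : Prop :=
  ∀ i j, i ≠ j → B i j ≤ 0

/-- L-matrix: a Z-matrix with positive diagonal. -/
def IsLMatrix (B : Matrix (Fin n) (Fin n) ℝ) : Prop :=
  IsZMatrix B ∧ ∀ i, 0 < B i i

/-- `B` is reducible if some simultaneous permutation of its rows and columns is block upper
triangular, with diagonal blocks of sizes `r` and `n - r`, `1 ≤ r ≤ n - 1`. -/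
def IsReducible (B : Matrix (Fin n) (Fin n) ℝ) : Prop :=
  ∃ (σ : Equiv.Perm (Fin n)) (r : ℕ), 1 ≤ r ∧ r < n ∧
    ∀ i j : Fin n, r ≤ (i : ℕ) → (j : ℕ) < r → B (σ i) (σ j) = 0

/-- Irreducible: not reducible. -/
def IsIrred (B : Matrix (Fin n) (Fin n) ℝ) : Prop := ¬ IsReducible B

/-- The diagonal part of a matrix. -/
def diagPart (B : Matrix (Fin n) (Fin n) ℝ) : Matrix (Fin n) (Fin n) ℝ :=
  Matrix.of fun i j => if i = j then B i j else 0

/-- The strictly lower triangular part of a matrix. -/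
def lowPart (B : Matrix (Fin n) (Fin n) ℝ) : Matrix (Fin n) (Fin n) ℝ :=
  Matrix.of fun i j => if j < i then B i j else 0

/-- The strictly upper triangular part of a matrix. -/
def upPart (B : Matrix (Fin n) (Fin n) ℝ) : Matrix (Fin n) (Fin n) ℝ :=
  Matrix.of fun i j => if i < j then B i j else 0

/-- The matrix `L` of the decomposition `B = D - L - U`, where `D = diagPart B`. -/
def matL (B : Matrix (Fin n) (Fin n) ℝ) : Matrix (Fin n) (Fin n) ℝ := -lowPart B

/-- The matrix `U` of the decomposition `B = D - L - U`, where `D = diagPart B`. -/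
def matU (B : Matrix (Fin n) (Fin n) ℝ) : Matrix (Fin n) (Fin n) ℝ := -upPart B

/-- The AOR iteration matrix `(D - γ L)⁻¹ [(1 - ω) D + (ω - γ) L + ω U]` of `B = D - L - U`. -/
def aor (γ ω : ℝ) (B : Matrix (Fin n) (Fin n) ℝ) : Matrix (Fin n) (Fin n) ℝ :=
  (diagPart B - γ • matL B)⁻¹ *
    ((1 - ω) • diagPart B + (ω - γ) • matL B + ω • matU B)

/-- The spectral radius of a real square matrix: the largest modulus of its complex eigenvalues. -/
def rho (B : Matrix (Fin n) (Fin n) ℝ) : ℝ≥0∞ :=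
  spectralRadius ℂ (B.map (algebraMap ℝ ℂ))

/-- The admissible matrices `Q`: zero diagonal, nonnegative off-diagonal entries, and the
off-diagonal entries do not sum to zero. -/
structure IsAdmissibleQ (Q : Matrix (Fin n) (Fin n) ℝ) : Prop where
  diag_eq_zero : ∀ i, Q i i = 0
  offDiag_nonneg : ∀ i j, i ≠ j → 0 ≤ Q i j
  sum_ne_zero : ∑ i, ∑ j with j ≠ i, Q i j ≠ 0

/-- The preconditioned matrix `P A` with `P = I + Q`. -/
def precond (Q A : Matrix (Fin n) (Fin n) ℝ) : Matrix (Fin n) (Fin n) ℝ := (1 + Q) * A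

/-- The matrix `Δ(γ) = (E₁ + E₂) + γ F₁ + γ F₂ + γ Q⁽ᵘ⁾ U + (1 - γ) Q`, where `Q⁽ˡ⁾`, `Q⁽ᵘ⁾` are the
strictly lower and upper triangular parts of `Q`, and `E₁`, `F₁` (resp. `E₂`, `F₂`) are the
diagonal and strictly lower triangular parts of `Q⁽ˡ⁾ U` (resp. `Q⁽ᵘ⁾ L`). -/
def Delta (A Q : Matrix (Fin n) (Fin n) ℝ) (γ : ℝ) : Matrix (Fin n) (Fin n) ℝ :=
  (diagPart (lowPart Q * matU A) + diagPart (upPart Q * matL A))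
    + γ • lowPart (lowPart Q * matU A)
    + γ • lowPart (upPart Q * matL A)
    + γ • (upPart Q * matU A)
    + (1 - γ) • Q

/-- The last index (`n` in one-based numbering); the first one is `0`. -/
def lastIdx [NeZero n] : Fin n := ⟨n - 1, Nat.sub_lt (Nat.pos_of_ne_zero (NeZero.ne n)) one_pos⟩

/-- The alternatives accompanying irreducibility of `P A` when `γ = 1`. -/
def GlobalCond [NeZero n] (A Q : Matrix (Fin n) (Fin n) ℝ) : Prop :=
  (∃ i j, 0 < Delta A Q 1 i j) ∨
  (0 < Q lastIdx 0) ∨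
  (∃ k k' : Fin n, (k' : ℕ) = k + 1 ∧ 0 < Q k k') ∨
  (∃ i j, Q i j * A j i < 0) ∨
  (∃ i j, i < lastIdx ∧ j ≤ i ∧ Q i lastIdx * A lastIdx j < 0) ∨
  (∃ i j, i < j ∧ Q i j * A j 0 < 0) ∨
  (∃ i j j' : Fin n, (j' : ℕ) = j + 1 ∧ Q i j * A j j' < 0) ∨
  (∃ i j, 0 < j ∧ j ≤ i ∧ Q i 0 * A 0 j < 0) ∨
  (A lastIdx 0 < 0 ∧ ∀ k k' : Fin n, (k' : ℕ) = k + 1 → A k k' < 0)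

/-- The first six alternatives for the row `i` when `γ = 1`. -/
def RowCond [NeZero n] (A Q : Matrix (Fin n) (Fin n) ℝ) (i : Fin n) : Prop :=
  (∃ j, 0 < Delta A Q 1 i j) ∨
  (∃ i' : Fin n, (i' : ℕ) = i + 1 ∧ 0 < Q i i') ∨
  (∃ j, Q i j * A j i < 0) ∨
  (∃ j, j ≤ i ∧ Q i lastIdx * A lastIdx j < 0) ∨
  (∃ j, i < j ∧ Q i j * A j 0 < 0) ∨
  (∃ j j' : Fin n, (j' : ℕ) = j + 1 ∧ Q i j * A j j' < 0)

/-- The seventh alternative for the row `i` when `γ = 1`. -/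
def RowCond7 [NeZero n] (A Q : Matrix (Fin n) (Fin n) ℝ) (i : Fin n) : Prop :=
  ∃ j, 0 < j ∧ j ≤ i ∧ Q i 0 * A 0 j < 0

/-- `a_{n,j} + q_{n,j} + ∑_{1 ≤ k ≤ n-1, k ≠ j} q_{n,k} a_{k,j}` in one-based numbering. -/
def lastRowExpr [NeZero n] (A Q : Matrix (Fin n) (Fin n) ℝ) (j : Fin n) : ℝ :=
  A lastIdx j + Q lastIdx j + ∑ k with k < lastIdx ∧ k ≠ j, Q lastIdx k * A k j

/-- The alternatives accompanying the row conditions when `γ = 1`. -/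
def LastRowCond [NeZero n] (A Q : Matrix (Fin n) (Fin n) ℝ) : Prop :=
  (∃ j k, k < j ∧ Q lastIdx k * A k j < 0) ∨
  (0 < Q lastIdx 0) ∨
  (∃ j, 0 < j ∧ j < lastIdx ∧ lastRowExpr A Q j < 0) ∨
  (RowCond A Q 0 ∧ lastRowExpr A Q 0 < 0) ∨
  (RowCond A Q 0 ∧ A lastIdx 0 < 0)

/-- The strict Stein–Rosenberg trichotomy for `r₁ = ρ(L⁽¹⁾)` and `r = ρ(L)`: one of three
mutually exclusive relations holds. -/
def StrictTrichotomy (r₁ r : ℝ≥0∞) : Prop :=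
  ((r₁ < r ∧ r < 1) ∨ (r₁ = r ∧ r = 1) ∨ (r < r₁ ∧ 1 < r)) ∧
  ¬ ((r₁ < r ∧ r < 1) ∧ (r₁ = r ∧ r = 1)) ∧
  ¬ ((r₁ < r ∧ r < 1) ∧ (r < r₁ ∧ 1 < r)) ∧
  ¬ ((r₁ = r ∧ r = 1) ∧ (r < r₁ ∧ 1 < r))

end

end PrecondAOR

open PrecondAOR

-- Write `A = M - N` with `M = D - γL` and `N = (1 - γ)L + U`. The AOR matrix is then `(1 - ω)I + ω
-- M⁻¹N`, a nonnegative matrix, so its spectral radius is `1 - ω + ωl` with `l` an eigenvalue of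
-- `M⁻¹N`. Let `M₁`, `N₁`, `l₁` be the same objects for `PA`, where `P = I + Q`.
--
-- Take a right Perron vector `x` of `A`: `Nx = l Mx`, where irreducibility gives `x > 0` and `l >
-- 0` (`exists_right_vector`). Take a left vector `v ≥ 0` with `v N₁ = l₁ v M₁`
-- (`exists_left_vector`). The preconditioner satisfies `PM = M₁ + G + Q⁽ᵘ⁾M` with `G ≥ 0`
-- (`precond_mul_splitM`). Since `Mx = l⁻¹Nx`, this gives `PMx = M₁x + y` with `y = Gx + l⁻¹Q⁽ᵘ⁾Nx ≥
-- 0`. Evaluating `v(PA)x` from both sides yields `(l₁ - l) · (v M₁ x) = (l - 1) · (v · y)` with `v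
-- M₁ x > 0`. The strict trichotomy follows as soon as `v · y > 0`.
--
-- If `v · y = 0`, then `l₁ = l > 0`. In that case the support of `v` is closed along the nonzero
-- entries of `PA` and has at least two elements. Each of the conditions (i)–(iv) forces such a
-- support to meet an active row, that is, a row where `y` is positive, or else contradicts
-- closedness (`strictTrichotomy_of_activeRow`, `exists_activeRow_of_rowCond`).

namespace PrecondAOR

open Matrix Filter Topology

-- Perron–Frobenius theory for nonnegative matrices.

section Perron

variable {ι : Type*} [Fintype ι]

lemma mulVec_nonneg_of_nonneg {S : Matrix ι ι ℝ} (hS : ∀ i j, 0 ≤ S i j) {x : ι → ℝ}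
    (hx : ∀ i, 0 ≤ x i) (i : ι) : 0 ≤ (S *ᵥ x) i :=
  Finset.sum_nonneg fun j _ => mul_nonneg (hS i j) (hx j)

lemma mulVec_pos_of_entry_pos {S : Matrix ι ι ℝ} (hS : ∀ i j, 0 ≤ S i j) {x : ι → ℝ}
    (hx : ∀ i, 0 ≤ x i) {i j : ι} (hij : 0 < S i j) (hj : 0 < x j) : 0 < (S *ᵥ x) i :=
  Finset.sum_pos' (fun k _ => mul_nonneg (hS i k) (hx k)) ⟨j, Finset.mem_univ j, mul_pos hij hj⟩

lemma exists_pos_of_nonneg_of_ne_zero {κ : Type*} {x : κ → ℝ} (hx : ∀ i, 0 ≤ x i) (h0 : x ≠ 0) :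
    ∃ i, 0 < x i := by
  obtain ⟨i, hi⟩ := Function.ne_iff.1 h0
  exact ⟨i, lt_of_le_of_ne (hx i) (Ne.symm hi)⟩

lemma sum_pos_of_nonneg_of_ne_zero {x : ι → ℝ} (hx : ∀ i, 0 ≤ x i) (h0 : x ≠ 0) :
    0 < ∑ i, x i := by
  obtain ⟨i, hi⟩ := exists_pos_of_nonneg_of_ne_zero hx h0
  exact Finset.sum_pos' (fun k _ => hx k) ⟨i, Finset.mem_univ i, hi⟩

lemma inv_sum_smul_mem_stdSimplex {x : ι → ℝ} (hx : ∀ i, 0 ≤ x i) (h0 : x ≠ 0) :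
    (∑ i, x i)⁻¹ • x ∈ stdSimplex ℝ ι := by
  have h := sum_pos_of_nonneg_of_ne_zero hx h0
  refine ⟨fun i => mul_nonneg (inv_nonneg.2 h.le) (hx i), ?_⟩
  simp only [Pi.smul_apply, smul_eq_mul, ← Finset.mul_sum]
  exact inv_mul_cancel₀ h.ne'

lemma ne_zero_of_mem_stdSimplex {x : ι → ℝ} (hx : x ∈ stdSimplex ℝ ι) : x ≠ 0 := by
  rintro rfl
  simpa using hx.2

/-- A normalised subinvariant vector bounds its constant by the sum of the image. -/
lemma le_sum_mulVec {S : Matrix ι ι ℝ} {x : ι → ℝ} (hx : x ∈ stdSimplex ℝ ι) {c : ℝ}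
    (h : ∀ i, c * x i ≤ (S *ᵥ x) i) : c ≤ ∑ i, (S *ᵥ x) i := by
  calc c = ∑ i, c * x i := by rw [← Finset.mul_sum, hx.2, mul_one]
    _ ≤ _ := Finset.sum_le_sum fun i _ => h i

/-- Perron's theorem for a positive matrix, with the Collatz–Wielandt bound. -/
theorem exists_perron_vector_of_pos [Nonempty ι] {S : Matrix ι ι ℝ} (hS : ∀ i j, 0 < S i j) :
    ∃ x ∈ stdSimplex ℝ ι, ∃ r : ℝ, S *ᵥ x = r • x ∧
      ∀ y ∈ stdSimplex ℝ ι, ∀ c : ℝ, (∀ i, c * y i ≤ (S *ᵥ y) i) → c ≤ r := by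
  classical
  have hS0 : ∀ i j, 0 ≤ S i j := fun i j => (hS i j).le
  set R : ℝ := ∑ i, ∑ j, S i j with hR
  have hbound : ∀ x ∈ stdSimplex ℝ ι, ∑ i, (S *ᵥ x) i ≤ R := by
    intro x hx
    refine Finset.sum_le_sum fun i _ => Finset.sum_le_sum fun j _ => ?_
    exact mul_le_of_le_one_right (hS0 i j) ((mem_Icc_of_mem_stdSimplex hx j).2)
  -- Pairs `(c, x)` with `c x ≤ Sx` form a compact set; the Perron root is the largest `c` in it.
  let K : Set (ℝ × (ι → ℝ)) :=
    (Set.Icc 0 R ×ˢ stdSimplex ℝ ι) ∩ {p | ∀ i, p.1 * p.2 i ≤ (S *ᵥ p.2) i}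
  have hKc : IsCompact K := by
    refine (isCompact_Icc.prod (isCompact_stdSimplex ℝ ι)).inter_right ?_
    simp only [Set.ofPred_forall]
    refine isClosed_iInter fun i => isClosed_le (by fun_prop) ?_
    simp only [Matrix.mulVec, dotProduct]
    fun_prop
  obtain ⟨i₀⟩ := ‹Nonempty ι›
  have hKn : K.Nonempty := by
    refine ⟨(0, Pi.single i₀ 1), ⟨⟨⟨le_rfl, ?_⟩, single_mem_stdSimplex ℝ i₀⟩, fun i => ?_⟩⟩
    · exact Finset.sum_nonneg fun i _ => Finset.sum_nonneg fun j _ => hS0 i j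
    · simpa using mulVec_nonneg_of_nonneg hS0 (single_mem_stdSimplex ℝ i₀).1 i
  obtain ⟨⟨r, x⟩, ⟨⟨hr, hx⟩, hrx⟩, hmax⟩ := hKc.exists_isMaxOn hKn continuous_fst.continuousOn
  simp only at hr hx hrx
  have hcw : ∀ y ∈ stdSimplex ℝ ι, ∀ c : ℝ, (∀ i, c * y i ≤ (S *ᵥ y) i) → c ≤ r := by
    intro y hy c hc
    rcases le_or_gt c 0 with h | h
    · exact h.trans hr.1
    · exact hmax (a := (c, y)) ⟨⟨⟨h.le, (le_sum_mulVec hy hc).trans (hbound y hy)⟩, hy⟩, hc⟩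
  refine ⟨x, hx, r, ?_, hcw⟩
  by_contra hne
  -- A nonzero defect `z ≥ 0` is mapped to `Sz > 0`. Hence `y = Sx` satisfies `Sy ≥ (r + δ)y` for
  -- some `δ > 0`, against the maximality of `r`.
  set z : ι → ℝ := S *ᵥ x - r • x with hz
  have hz0 : ∀ i, 0 ≤ z i := fun i => by simpa [hz] using hrx i
  have hzne : z ≠ 0 := fun h => hne (sub_eq_zero.1 h)
  obtain ⟨k, hk⟩ := exists_pos_of_nonneg_of_ne_zero hz0 hzne
  obtain ⟨l, hl⟩ := exists_pos_of_nonneg_of_ne_zero hx.1 (ne_zero_of_mem_stdSimplex hx)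
  set y : ι → ℝ := S *ᵥ x with hy
  have hypos : ∀ i, 0 < y i := fun i => mulVec_pos_of_entry_pos hS0 hx.1 (hS i l) hl
  have hSz : ∀ i, 0 < (S *ᵥ z) i := fun i => mulVec_pos_of_entry_pos hS0 hz0 (hS i k) hk
  have hSz' : ∀ i, (S *ᵥ z) i = (S *ᵥ y) i - r * y i := fun i => by
    rw [hz, Matrix.mulVec_sub, Matrix.mulVec_smul]; rfl
  obtain ⟨m, -, hm⟩ := Finset.exists_min_image Finset.univ (fun i => (S *ᵥ z) i / y i)
    ⟨i₀, Finset.mem_univ _⟩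
  set δ := (S *ᵥ z) m / y m
  have hδ : 0 < δ := div_pos (hSz m) (hypos m)
  have hyne : y ≠ 0 := fun h => (hypos i₀).ne' (congrFun h i₀)
  have := hcw _ (inv_sum_smul_mem_stdSimplex (fun i => (hypos i).le) hyne) (r + δ) (fun i => by
    have h1 : δ ≤ (S *ᵥ z) i / y i := hm i (Finset.mem_univ _)
    rw [le_div_iff₀ (hypos i), hSz'] at h1
    have h2 : 0 ≤ (∑ i, y i)⁻¹ := inv_nonneg.2 (Finset.sum_nonneg fun i _ => (hypos i).le)
    rw [Matrix.mulVec_smul]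
    simp only [Pi.smul_apply, smul_eq_mul]
    nlinarith)
  linarith

/-- The Perron–Frobenius theorem for a nonnegative matrix, with the Collatz–Wielandt bound. -/
theorem exists_perron_vector [Nonempty ι] {S : Matrix ι ι ℝ} (hS : ∀ i j, 0 ≤ S i j) :
    ∃ x ∈ stdSimplex ℝ ι, ∃ r : ℝ, S *ᵥ x = r • x ∧
      ∀ y ∈ stdSimplex ℝ ι, ∀ c : ℝ, (∀ i, c * y i ≤ (S *ᵥ y) i) → c ≤ r := by
  -- Perturb by `ε J`, with `J` the all-ones matrix, to reach the positive case, then pass to a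
  -- convergent subsequence of Perron vectors.
  let ε : ℕ → ℝ := fun m => 1 / ((m : ℝ) + 1)
  have hε : ∀ m, 0 < ε m := fun m => Nat.one_div_pos_of_nat
  have hε0 : Tendsto ε atTop (𝓝 0) := tendsto_one_div_add_atTop_nhds_zero_nat
  let J : Matrix ι ι ℝ := Matrix.of fun _ _ => 1
  have key : ∀ m, ∃ x ∈ stdSimplex ℝ ι, ∃ r : ℝ, (S + ε m • J) *ᵥ x = r • x ∧
      ∀ y ∈ stdSimplex ℝ ι, ∀ c : ℝ, (∀ i, c * y i ≤ ((S + ε m • J) *ᵥ y) i) → c ≤ r :=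
    fun m => exists_perron_vector_of_pos fun i j => by
      simpa [J] using add_pos_of_nonneg_of_pos (hS i j) (hε m)
  choose x hx r hr hcw using key
  obtain ⟨a, ha, φ, hφ, hlim⟩ := (isCompact_stdSimplex ℝ ι).tendsto_subseq hx
  have hJ : ∀ y ∈ stdSimplex ℝ ι, ∀ m i, ((S + ε m • J) *ᵥ y) i = (S *ᵥ y) i + ε m := by
    intro y hy m i
    have : (J *ᵥ y) i = 1 := by simpa [J, Matrix.mulVec, dotProduct] using hy.2
    rw [Matrix.add_mulVec, Matrix.smul_mulVec]
    simp [this]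
  have hrow : ∀ m i, (S *ᵥ x m) i + ε m = r m * x m i := fun m i => by
    rw [← hJ _ (hx m), hr]; rfl
  -- On the simplex the eigenvalue is the coordinate sum of the image, so it converges along with
  -- the vectors.
  have hrsum : ∀ m, r m = ∑ i, ((S *ᵥ x m) i + ε m) := fun m => by
    simp only [hrow, ← Finset.mul_sum, (hx m).2, mul_one]
  have hεφ : Tendsto (fun m => ε (φ m)) atTop (𝓝 0) := hε0.comp hφ.tendsto_atTop
  have hSx : ∀ i, Tendsto (fun m => (S *ᵥ x (φ m)) i) atTop (𝓝 ((S *ᵥ a) i)) := by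
    intro i
    have hc : Continuous fun y : ι → ℝ => (S *ᵥ y) i := by
      simp only [Matrix.mulVec, dotProduct]; fun_prop
    exact (hc.tendsto a).comp hlim
  have hrlim : Tendsto (fun m => r (φ m)) atTop (𝓝 (∑ i, (S *ᵥ a) i)) := by
    simp only [hrsum]
    simpa using tendsto_finsetSum Finset.univ fun i _ => (hSx i).add hεφ
  refine ⟨a, ha, ∑ i, (S *ᵥ a) i, ?_, ?_⟩
  · funext i
    have h1 := (hSx i).add hεφ
    simp only [hrow, add_zero] at h1
    exact tendsto_nhds_unique h1 (hrlim.mul ((continuous_apply i).tendsto a |>.comp hlim))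
  · intro y hy c hc
    refine ge_of_tendsto' hrlim fun m => hcw _ y hy c fun i => ?_
    rw [hJ y hy]
    linarith [hc i, hε (φ m)]

lemma exists_eigenvector_of_mem_spectrum [DecidableEq ι] {T : Matrix ι ι ℂ} {z : ℂ}
    (hz : z ∈ spectrum ℂ T) : ∃ u : ι → ℂ, u ≠ 0 ∧ T *ᵥ u = z • u := by
  rw [spectrum.mem_iff, Matrix.isUnit_iff_isUnit_det, isUnit_iff_ne_zero, not_not,
    ← Matrix.exists_mulVec_eq_zero_iff] at hz
  obtain ⟨u, hu, h⟩ := hz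
  refine ⟨u, hu, ?_⟩
  rw [Matrix.sub_mulVec, sub_eq_zero, Algebra.algebraMap_eq_smul_one, Matrix.smul_mulVec,
    Matrix.one_mulVec] at h
  exact h.symm

lemma mem_spectrum_of_eigenvector [DecidableEq ι] {T : Matrix ι ι ℂ} {z : ℂ} {u : ι → ℂ}
    (hu : u ≠ 0) (h : T *ᵥ u = z • u) : z ∈ spectrum ℂ T := by
  rw [spectrum.mem_iff, Matrix.isUnit_iff_isUnit_det, isUnit_iff_ne_zero, not_not,
    ← Matrix.exists_mulVec_eq_zero_iff]
  refine ⟨u, hu, ?_⟩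
  rw [Matrix.sub_mulVec, sub_eq_zero, Algebra.algebraMap_eq_smul_one, Matrix.smul_mulVec,
    Matrix.one_mulVec, h]

end Perron

/-- The spectral radius of a nonnegative matrix is an eigenvalue with a nonnegative eigenvector. -/
theorem exists_mulVec_eq_rho {n : ℕ} [NeZero n] {S : Matrix (Fin n) (Fin n) ℝ}
    (hS : ∀ i j, 0 ≤ S i j) :
    ∃ (r : ℝ) (x : Fin n → ℝ), 0 ≤ r ∧ rho S = ENNReal.ofReal r ∧ (∀ i, 0 ≤ x i) ∧ x ≠ 0 ∧
      S *ᵥ x = r • x := by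
  obtain ⟨x, hx, r, hr, hcw⟩ := exists_perron_vector hS
  have hr0 : 0 ≤ r := hcw x hx 0 fun i => by
    simpa using mulVec_nonneg_of_nonneg hS hx.1 i
  refine ⟨r, x, hr0, ?_, hx.1, ne_zero_of_mem_stdSimplex hx, hr⟩
  apply le_antisymm
  -- For a complex eigenpair `(z, u)` the triangle inequality gives `|z| |u| ≤ S|u|`, and the
  -- Collatz–Wielandt bound applies to the normalised `|u|`.
  · refine iSup₂_le fun z hz => ?_
    obtain ⟨u, hu, h⟩ := exists_eigenvector_of_mem_spectrum hz
    have hu' : (fun i => ‖u i‖) ≠ 0 := fun h0 => hu (funext fun i => by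
      simpa using congrFun h0 i)
    have hz' := hcw _ (inv_sum_smul_mem_stdSimplex (fun i => norm_nonneg (u i)) hu') ‖z‖ fun i => by
      have h1 : ‖z‖ * ‖u i‖ ≤ (S *ᵥ fun i => ‖u i‖) i := by
        have h2 : z * u i = ∑ j, (S i j : ℂ) * u j := (congrFun h i).symm
        rw [← norm_mul, h2]
        refine (norm_sum_le _ _).trans (Finset.sum_le_sum fun j _ => ?_)
        rw [norm_mul, Complex.norm_real, Real.norm_of_nonneg (hS i j)]
      have h2 : 0 ≤ (∑ i, ‖u i‖)⁻¹ := inv_nonneg.2 (Finset.sum_nonneg fun i _ => norm_nonneg _)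
      rw [Matrix.mulVec_smul]
      simp only [Pi.smul_apply, smul_eq_mul]
      nlinarith
    exact ENNReal.coe_le_coe.2 (NNReal.le_toNNReal_of_coe_le hz')
  · have hmem : ((r : ℝ) : ℂ) ∈ spectrum ℂ (S.map (algebraMap ℝ ℂ)) := by
      refine mem_spectrum_of_eigenvector (u := fun i => (x i : ℂ)) ?_ ?_
      · intro h
        exact ne_zero_of_mem_stdSimplex hx (funext fun i => by simpa using congrFun h i)
      · funext i
        have := congrArg (fun t : ℝ => (t : ℂ)) (congrFun hr i)
        simpa [Matrix.mulVec, dotProduct] using this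
    refine le_trans (le_of_eq ?_)
      (le_iSup₂ (f := fun k (_ : k ∈ spectrum ℂ _) => (‖k‖₊ : ℝ≥0∞)) _ hmem)
    rw [Complex.nnnorm_real, ← Real.toNNReal_eq_nnnorm_of_nonneg hr0]
    rfl

/-- A nonnegative matrix has a nonnegative left eigenvector for its spectral radius. -/
theorem exists_vecMul_eq_rho {n : ℕ} [NeZero n] {S : Matrix (Fin n) (Fin n) ℝ}
    (hS : ∀ i j, 0 ≤ S i j) :
    ∃ (r : ℝ) (w : Fin n → ℝ), 0 ≤ r ∧ rho S = ENNReal.ofReal r ∧ (∀ i, 0 ≤ w i) ∧ w ≠ 0 ∧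
      w ᵥ* S = r • w := by
  obtain ⟨r, w, hr, hrho, hw, hw0, h⟩ := exists_mulVec_eq_rho (S := Sᵀ) fun i j => hS j i
  refine ⟨r, w, hr, ?_, hw, hw0, by rwa [Matrix.mulVec_transpose] at h⟩
  rw [← hrho]
  unfold rho spectralRadius
  rw [Matrix.transpose_map]
  have : spectrum ℂ (S.map (algebraMap ℝ ℂ))ᵀ = spectrum ℂ (S.map (algebraMap ℝ ℂ)) := by
    ext z
    rw [Matrix.mem_spectrum_iff_isRoot_charpoly, Matrix.mem_spectrum_iff_isRoot_charpoly,
      Matrix.charpoly_transpose]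
  rw [this]

variable {n : ℕ}

-- Irreducibility in terms of closed index sets.

section Irreducible

/-- A permutation listing a proper nonempty closed `T` last would exhibit the block form with `r = n
- |T|`. -/
lemma IsIrred.eq_univ_of_closed {B : Matrix (Fin n) (Fin n) ℝ} (hB : IsIrred B)
    {T : Finset (Fin n)} (hT : T.Nonempty) (hcl : ∀ i ∈ T, ∀ j ∉ T, B i j = 0) :
    T = Finset.univ := by
  by_contra hne
  apply hB
  have hlt : T.card < n := by
    simpa using Finset.card_lt_card (Finset.ssubset_univ_iff.2 hne)
  have hpos := hT.card_pos
  have hcard : Fintype.card {i : Fin n // n - T.card ≤ (i : ℕ)} = Fintype.card {i // i ∈ T} := by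
    rw [Fintype.card_coe, Fintype.card_subtype]
    have : (Finset.univ.filter fun i : Fin n => n - T.card ≤ (i : ℕ)) =
        Finset.Ici ⟨n - T.card, by omega⟩ := by
      ext i; simp [Fin.le_def]
    rw [this, Fin.card_Ici]
    simp only
    omega
  let σ := (Fintype.equivOfCardEq hcard).extendSubtype
  refine ⟨σ, n - T.card, by omega, by omega, fun i j hi hj => hcl _ ?_ _ ?_⟩
  · exact Equiv.extendSubtype_mem (Fintype.equivOfCardEq hcard) i hi
  · exact Equiv.extendSubtype_not_mem (Fintype.equivOfCardEq hcard) j (by omega)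

lemma IsIrred.exists_ne_zero {B : Matrix (Fin n) (Fin n) ℝ} (hB : IsIrred B) (hn : 1 < n)
    (i : Fin n) : ∃ j, j ≠ i ∧ B i j ≠ 0 := by
  by_contra! h
  have := hB.eq_univ_of_closed (T := {i}) (by simp) (by simpa using h)
  have hc := congrArg Finset.card this
  simp at hc
  omega

end Irreducible

-- The splitting behind AOR and its Perron vectors.

section Splitting

/-- The lower triangular part `D - γ L` of the AOR splitting of `B = D - L - U`. -/
noncomputable def splitM (γ : ℝ) (B : Matrix (Fin n) (Fin n) ℝ) : Matrix (Fin n) (Fin n) ℝ :=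
  diagPart B - γ • matL B

/-- The part `(1 - γ) L + U` of the AOR splitting of `B = D - L - U` with `ω = 1`. -/
noncomputable def splitN (γ : ℝ) (B : Matrix (Fin n) (Fin n) ℝ) : Matrix (Fin n) (Fin n) ℝ :=
  (1 - γ) • matL B + matU B

variable {γ ω : ℝ} {B : Matrix (Fin n) (Fin n) ℝ}

lemma splitM_apply_self (i : Fin n) : splitM γ B i i = B i i := by
  simp [splitM, diagPart, matL, lowPart]

lemma splitM_apply_of_lt {i j : Fin n} (h : j < i) : splitM γ B i j = γ * B i j := by
  simp [splitM, diagPart, matL, lowPart, h, h.ne']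

lemma splitM_apply_of_gt {i j : Fin n} (h : i < j) : splitM γ B i j = 0 := by
  simp [splitM, diagPart, matL, lowPart, h.not_gt, h.ne]

lemma splitN_apply_self (i : Fin n) : splitN γ B i i = 0 := by
  simp [splitN, matU, upPart, matL, lowPart]

lemma splitN_apply_of_lt {i j : Fin n} (h : j < i) : splitN γ B i j = -((1 - γ) * B i j) := by
  simp [splitN, matU, upPart, matL, lowPart, h, h.not_gt]

lemma splitN_apply_of_gt {i j : Fin n} (h : i < j) : splitN γ B i j = -B i j := by
  simp [splitN, matU, upPart, matL, lowPart, h, h.not_gt]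

lemma splitM_sub_splitN (γ : ℝ) (B : Matrix (Fin n) (Fin n) ℝ) :
    splitM γ B - splitN γ B = B := by
  ext i j
  rw [Matrix.sub_apply]
  rcases lt_trichotomy i j with h | rfl | h
  · rw [splitM_apply_of_gt h, splitN_apply_of_gt h]; ring
  · rw [splitM_apply_self, splitN_apply_self]; ring
  · rw [splitM_apply_of_lt h, splitN_apply_of_lt h]; ring

lemma splitM_nonpos (hB : IsLMatrix B) (hγ0 : 0 ≤ γ) {i j : Fin n} (hij : i ≠ j) :
    splitM γ B i j ≤ 0 := by
  rcases lt_or_gt_of_ne hij with h | h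
  · rw [splitM_apply_of_gt h]
  · rw [splitM_apply_of_lt h]
    exact mul_nonpos_of_nonneg_of_nonpos hγ0 (hB.1 i j hij)

lemma splitN_nonneg (hB : IsLMatrix B) (hγ1 : γ ≤ 1) (i j : Fin n) : 0 ≤ splitN γ B i j := by
  rcases lt_trichotomy i j with h | rfl | h
  · rw [splitN_apply_of_gt h]
    linarith [hB.1 i j h.ne]
  · rw [splitN_apply_self]
  · rw [splitN_apply_of_lt h]
    linarith [mul_nonpos_of_nonneg_of_nonpos (sub_nonneg.2 hγ1) (hB.1 i j h.ne')]

/-- Forward substitution: the matrix is lower triangular with positive diagonal and nonpositive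
entries below it. This monotonicity yields both invertibility and a nonnegative inverse. -/
lemma nonneg_of_splitM_mulVec_nonneg (hB : IsLMatrix B) (hγ0 : 0 ≤ γ) {u : Fin n → ℝ}
    (h : ∀ i, 0 ≤ (splitM γ B *ᵥ u) i) (i : Fin n) : 0 ≤ u i := by
  induction i using WellFoundedLT.induction with
  | ind i ih =>
    by_contra! hi
    have hi' : 0 ≤ ∑ j, splitM γ B i j * u j := h i
    refine hi'.not_gt (Finset.sum_neg' (fun j _ => ?_) ⟨i, Finset.mem_univ i, ?_⟩)
    · rcases lt_trichotomy i j with hij | rfl | hij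
      · rw [splitM_apply_of_gt hij, zero_mul]
      · rw [splitM_apply_self]
        exact mul_nonpos_of_nonneg_of_nonpos (hB.2 i).le hi.le
      · exact mul_nonpos_of_nonpos_of_nonneg (splitM_nonpos hB hγ0 hij.ne') (ih j hij)
    · rw [splitM_apply_self]
      exact mul_neg_of_pos_of_neg (hB.2 i) hi

lemma isUnit_det_splitM (hB : IsLMatrix B) (hγ0 : 0 ≤ γ) : IsUnit (splitM γ B).det := by
  rw [isUnit_iff_ne_zero]
  intro hdet
  obtain ⟨u, hu, h⟩ := Matrix.exists_mulVec_eq_zero_iff.2 hdet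
  refine hu (funext fun i => le_antisymm ?_ ?_)
  · have := nonneg_of_splitM_mulVec_nonneg (u := -u) hB hγ0 (fun i => by
      rw [Matrix.mulVec_neg, h]; simp) i
    simpa using this
  · exact nonneg_of_splitM_mulVec_nonneg hB hγ0 (fun i => by rw [h]; simp) i

lemma inv_splitM_nonneg (hB : IsLMatrix B) (hγ0 : 0 ≤ γ) (i j : Fin n) :
    0 ≤ (splitM γ B)⁻¹ i j := by
  have h := nonneg_of_splitM_mulVec_nonneg (u := (splitM γ B)⁻¹ *ᵥ Pi.single j 1) hB hγ0
    (fun i => by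
      rw [Matrix.mulVec_mulVec, Matrix.mul_nonsing_inv _ (isUnit_det_splitM hB hγ0),
        Matrix.one_mulVec]
      by_cases h : i = j
      · subst h; simp
      · simp [h]) i
  simpa using h

/-- Reduces every `ω` to extrapolation of the case `ω = 1`, so that only the eigenvalue of `M⁻¹N`
matters. -/
lemma aor_eq (hB : IsLMatrix B) (hγ0 : 0 ≤ γ) :
    aor γ ω B = (1 - ω) • 1 + ω • ((splitM γ B)⁻¹ * splitN γ B) := by
  have h : (1 - ω) • diagPart B + (ω - γ) • matL B + ω • matU B =
      (1 - ω) • splitM γ B + ω • splitN γ B := by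
    unfold splitM splitN
    module
  unfold aor
  rw [h]
  change (splitM γ B)⁻¹ * _ = _
  rw [Matrix.mul_add, Matrix.mul_smul, Matrix.mul_smul,
    Matrix.nonsing_inv_mul _ (isUnit_det_splitM hB hγ0)]

lemma inv_splitM_mul_splitN_nonneg (hB : IsLMatrix B) (hγ0 : 0 ≤ γ) (hγ1 : γ ≤ 1)
    (i j : Fin n) : 0 ≤ ((splitM γ B)⁻¹ * splitN γ B) i j := by
  rw [Matrix.mul_apply]
  exact Finset.sum_nonneg fun k _ => mul_nonneg (inv_splitM_nonneg hB hγ0 i k) (splitN_nonneg hB hγ1 k j)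

lemma aor_nonneg (hB : IsLMatrix B) (hγ0 : 0 ≤ γ) (hγ1 : γ ≤ 1) (hω0 : 0 < ω) (hω1 : ω ≤ 1)
    (i j : Fin n) : 0 ≤ aor γ ω B i j := by
  rw [aor_eq hB hγ0]
  have h1 : 0 ≤ (1 : Matrix (Fin n) (Fin n) ℝ) i j := by
    rw [Matrix.one_apply]; split_ifs <;> norm_num
  have h2 := inv_splitM_mul_splitN_nonneg hB hγ0 hγ1 i j
  simp only [Matrix.add_apply, Matrix.smul_apply, smul_eq_mul]
  have := sub_nonneg.2 hω1
  positivity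

/-- At a zero of `z`, an inequality `(N y) i ≤ l (M z) i` forces all terms to vanish. -/
lemma terms_eq_zero_of_apply_eq_zero (hB : IsLMatrix B) (hγ0 : 0 ≤ γ) (hγ1 : γ ≤ 1) {l : ℝ}
    (hl : 0 < l) {y z : Fin n → ℝ} (hy : ∀ i, 0 ≤ y i) (hz : ∀ i, 0 ≤ z i) {i : Fin n}
    (hzi : z i = 0) (h : (splitN γ B *ᵥ y) i ≤ l * (splitM γ B *ᵥ z) i) (j : Fin n) :
    splitN γ B i j * y j = 0 ∧ splitM γ B i j * z j = 0 := by
  have hN : ∀ j ∈ Finset.univ, 0 ≤ splitN γ B i j * y j :=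
    fun j _ => mul_nonneg (splitN_nonneg hB hγ1 i j) (hy j)
  -- The only positive entry of the row, the diagonal one, is killed by `z i = 0`; the two sides
  -- then have opposite signs.
  have hM : ∀ j ∈ Finset.univ, splitM γ B i j * z j ≤ 0 := fun j _ => by
    by_cases hij : i = j
    · rw [← hij, hzi, mul_zero]
    · exact mul_nonpos_of_nonpos_of_nonneg (splitM_nonpos hB hγ0 hij) (hz j)
  have hNs := Finset.sum_nonneg hN
  have hMs := Finset.sum_nonpos hM
  change ∑ j, splitN γ B i j * y j ≤ l * ∑ j, splitM γ B i j * z j at h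
  have h1 : ∑ j, splitN γ B i j * y j = 0 := by nlinarith
  have h2 : ∑ j, splitM γ B i j * z j = 0 := by nlinarith
  exact ⟨(Finset.sum_eq_zero_iff_of_nonneg hN).1 h1 j (Finset.mem_univ j),
    (Finset.sum_eq_zero_iff_of_nonpos hM).1 h2 j (Finset.mem_univ j)⟩

/-- For an irreducible L-matrix of order at least two, `M⁻¹ N` maps the all-ones vector to a
positive vector. -/
lemma inv_splitM_mul_splitN_mulVec_one_pos (hn : 1 < n) (hB : IsLMatrix B) (hirr : IsIrred B)
    (hγ0 : 0 ≤ γ) (hγ1 : γ ≤ 1) (i : Fin n) :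
    0 < (((splitM γ B)⁻¹ * splitN γ B) *ᵥ 1) i := by
  set z := ((splitM γ B)⁻¹ * splitN γ B) *ᵥ (1 : Fin n → ℝ) with hz
  have hz0 : ∀ i, 0 ≤ z i := fun i => mulVec_nonneg_of_nonneg
    (inv_splitM_mul_splitN_nonneg hB hγ0 hγ1) (fun _ => zero_le_one) i
  have hMz : splitM γ B *ᵥ z = splitN γ B *ᵥ 1 := by
    rw [hz, Matrix.mulVec_mulVec, ← Matrix.mul_assoc,
      Matrix.mul_nonsing_inv _ (isUnit_det_splitM hB hγ0), Matrix.one_mul]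
  have hterm : ∀ i, z i = 0 → ∀ j, splitN γ B i j = 0 ∧ splitM γ B i j * z j = 0 := by
    intro i hi j
    simpa using terms_eq_zero_of_apply_eq_zero hB hγ0 hγ1 one_pos (y := 1)
      (fun _ => zero_le_one) hz0 hi (by rw [hMz, one_mul]) j
  refine lt_of_le_of_ne (hz0 i) fun hi => ?_
  have huniv := hirr.eq_univ_of_closed (T := Finset.univ.filter fun k => z k = 0)
    ⟨i, by simpa using hi.symm⟩ (fun k hk j hj => by
      simp only [Finset.mem_filter, Finset.mem_univ, true_and] at hk hj
      have h := hterm k hk j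
      rw [← splitM_sub_splitN γ B, Matrix.sub_apply, h.1,
        (mul_eq_zero.1 h.2).resolve_right hj, sub_zero])
  -- The off-diagonal part of the first row lies above the diagonal, so `N` contains it in full even
  -- when `γ = 1`; it cannot vanish.
  obtain ⟨j, hj0, hj⟩ := hirr.exists_ne_zero hn ⟨0, by omega⟩
  have hlt : (⟨0, by omega⟩ : Fin n) < j := by
    rw [Fin.lt_def]
    rw [Ne, Fin.ext_iff] at hj0
    simp only at hj0 ⊢
    omega
  have hmem : (⟨0, by omega⟩ : Fin n) ∈ Finset.univ.filter fun k => z k = 0 := by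
    rw [huniv]; exact Finset.mem_univ _
  have h := (hterm _ (Finset.mem_filter.1 hmem).2 j).1
  rw [splitN_apply_of_gt hlt] at h
  exact hj (neg_eq_zero.1 h)

/-- A left eigenvector of the AOR matrix, in terms of the splitting. -/
lemma exists_left_vector [NeZero n] (hB : IsLMatrix B) (hγ0 : 0 ≤ γ) (hγ1 : γ ≤ 1)
    (hω0 : 0 < ω) (hω1 : ω ≤ 1) :
    ∃ (l : ℝ) (v : Fin n → ℝ), 0 ≤ 1 - ω + ω * l ∧
      rho (aor γ ω B) = ENNReal.ofReal (1 - ω + ω * l) ∧ (∀ i, 0 ≤ v i) ∧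
      (∀ i, 0 ≤ (v ᵥ* splitM γ B) i) ∧ v ᵥ* splitM γ B ≠ 0 ∧
      v ᵥ* splitN γ B = l • (v ᵥ* splitM γ B) := by
  obtain ⟨r, w, hr, hrho, hw, hw0, h⟩ := exists_vecMul_eq_rho (aor_nonneg hB hγ0 hγ1 hω0 hω1)
  have hdet := isUnit_det_splitM hB hγ0
  have hrl : 1 - ω + ω * ((r - (1 - ω)) / ω) = r := by field_simp; ring
  -- The vector sought is `v = w M⁻¹` for a left eigenvector `w`, so that `vM = w` is nonnegative
  -- and nonzero.
  have hvM : (w ᵥ* (splitM γ B)⁻¹) ᵥ* splitM γ B = w := by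
    rw [Matrix.vecMul_vecMul, Matrix.nonsing_inv_mul _ hdet, Matrix.vecMul_one]
  refine ⟨(r - (1 - ω)) / ω, w ᵥ* (splitM γ B)⁻¹, by rwa [hrl], by rwa [hrl],
    fun i => ?_, ?_, ?_, ?_⟩
  · change 0 ≤ ∑ k, w k * (splitM γ B)⁻¹ k i
    exact Finset.sum_nonneg fun k _ => mul_nonneg (hw k) (inv_splitM_nonneg hB hγ0 k i)
  · rwa [hvM]
  · rwa [hvM]
  · rw [hvM, Matrix.vecMul_vecMul]
    rw [aor_eq hB hγ0, Matrix.vecMul_add, Matrix.vecMul_smul, Matrix.vecMul_smul,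
      Matrix.vecMul_one] at h
    funext i
    have hi := congrFun h i
    simp only [Pi.add_apply, Pi.smul_apply, smul_eq_mul] at hi ⊢
    field_simp
    linarith

/-- A positive right eigenvector of the AOR matrix of an irreducible L-matrix, in terms of the
splitting. -/
lemma exists_right_vector (hn : 1 < n) (hB : IsLMatrix B) (hirr : IsIrred B)
    (hγ0 : 0 ≤ γ) (hγ1 : γ ≤ 1) (hω0 : 0 < ω) (hω1 : ω ≤ 1) :
    ∃ (l : ℝ) (x : Fin n → ℝ), 0 < l ∧
      rho (aor γ ω B) = ENNReal.ofReal (1 - ω + ω * l) ∧ (∀ i, 0 < x i) ∧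
      splitN γ B *ᵥ x = l • (splitM γ B *ᵥ x) := by
  have : NeZero n := ⟨by omega⟩
  obtain ⟨r, x, hr, hrho, hx, hx0, h⟩ := exists_mulVec_eq_rho (aor_nonneg hB hγ0 hγ1 hω0 hω1)
  obtain ⟨r', w, hr', hrho', hw, hw0, h'⟩ := exists_vecMul_eq_rho (aor_nonneg hB hγ0 hγ1 hω0 hω1)
  have hrr : r' = r := by
    rw [hrho, ENNReal.ofReal_eq_ofReal_iff hr hr'] at hrho'
    exact hrho'.symm
  subst hrr
  have hdet := isUnit_det_splitM hB hγ0
  set S := (splitM γ B)⁻¹ * splitN γ B with hS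
  have hrl : 1 - ω + ω * ((r' - (1 - ω)) / ω) = r' := by field_simp; ring
  -- Pairing the left eigenvector with the all-ones vector gives `r' ∑ w = (1 - ω) ∑ w + ω w·(S1)`,
  -- and `S1 > 0`; hence `r' > 1 - ω`.
  have hlpos : 0 < (r' - (1 - ω)) / ω := by
    have h1 : w ⬝ᵥ (aor γ ω B *ᵥ 1) = r' * ∑ i, w i := by
      rw [Matrix.dotProduct_mulVec, h']
      simp [dotProduct, Finset.mul_sum]
    rw [aor_eq hB hγ0, Matrix.add_mulVec, Matrix.smul_mulVec, Matrix.smul_mulVec,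
      Matrix.one_mulVec, dotProduct_add, dotProduct_smul, dotProduct_smul, dotProduct_one,
      smul_eq_mul, smul_eq_mul] at h1
    have h2 : 0 < w ⬝ᵥ (S *ᵥ 1) := by
      obtain ⟨k, hk⟩ := exists_pos_of_nonneg_of_ne_zero hw hw0
      have hp := inv_splitM_mul_splitN_mulVec_one_pos hn hB hirr hγ0 hγ1
      exact Finset.sum_pos' (fun i _ => mul_nonneg (hw i) (hp i).le)
        ⟨k, Finset.mem_univ k, mul_pos hk (hp k)⟩
    have h3 := sum_pos_of_nonneg_of_ne_zero hw hw0
    have h4 : 0 < ω * (w ⬝ᵥ (S *ᵥ 1)) := mul_pos hω0 h2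
    refine div_pos ?_ hω0
    by_contra! h5
    nlinarith
  have hNM : splitN γ B *ᵥ x = ((r' - (1 - ω)) / ω) • (splitM γ B *ᵥ x) := by
    have h1 : S *ᵥ x = ((r' - (1 - ω)) / ω) • x := by
      rw [aor_eq hB hγ0, Matrix.add_mulVec, Matrix.smul_mulVec, Matrix.smul_mulVec,
        Matrix.one_mulVec] at h
      funext i
      have hi := congrFun h i
      simp only [Pi.add_apply, Pi.smul_apply, smul_eq_mul] at hi ⊢
      field_simp
      linarith
    rw [← Matrix.mulVec_smul, ← h1, Matrix.mulVec_mulVec, hS, ← Matrix.mul_assoc,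
      Matrix.mul_nonsing_inv _ hdet, Matrix.one_mul]
  refine ⟨_, x, hlpos, by rwa [hrl], fun i => lt_of_le_of_ne (hx i) fun hi => ?_, hNM⟩
  -- The zero set of `x` is closed along the nonzero entries of `B`, so a single zero would force `x
  -- = 0`.
  have huniv := hirr.eq_univ_of_closed (T := Finset.univ.filter fun k => x k = 0)
    ⟨i, by simpa using hi.symm⟩ (fun k hk j hj => by
      simp only [Finset.mem_filter, Finset.mem_univ, true_and] at hk hj
      have h := terms_eq_zero_of_apply_eq_zero hB hγ0 hγ1 hlpos hx hx hk (by rw [hNM]; rfl) j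
      rw [← splitM_sub_splitN γ B, Matrix.sub_apply, (mul_eq_zero.1 h.1).resolve_right hj,
        (mul_eq_zero.1 h.2).resolve_right hj, sub_zero])
  refine hx0 (funext fun k => ?_)
  have hk : k ∈ Finset.univ.filter fun k => x k = 0 := by rw [huniv]; exact Finset.mem_univ _
  exact (Finset.mem_filter.1 hk).2

/-- The support of a left vector with `v N = l v M`, `0 < l`, is closed along the nonzero entries
of `B`. -/
lemma apply_eq_zero_of_left_vector (hB : IsLMatrix B) (hγ0 : 0 ≤ γ) (hγ1 : γ ≤ 1) {l : ℝ}
    (hl : 0 < l) {v : Fin n → ℝ} (hv : ∀ i, 0 ≤ v i)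
    (h : v ᵥ* splitN γ B = l • (v ᵥ* splitM γ B)) {i j : Fin n} (hi : 0 < v i) (hj : v j = 0) :
    B i j = 0 := by
  have hN : ∀ k ∈ Finset.univ, 0 ≤ v k * splitN γ B k j :=
    fun k _ => mul_nonneg (hv k) (splitN_nonneg hB hγ1 k j)
  have hM : ∀ k ∈ Finset.univ, v k * splitM γ B k j ≤ 0 := fun k _ => by
    by_cases hkj : k = j
    · rw [hkj, hj, zero_mul]
    · exact mul_nonpos_of_nonneg_of_nonpos (hv k) (splitM_nonpos hB hγ0 hkj)
  have hNs := Finset.sum_nonneg hN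
  have hMs := Finset.sum_nonpos hM
  have hj' : ∑ k, v k * splitN γ B k j = l * ∑ k, v k * splitM γ B k j := congrFun h j
  have h1 : ∑ k, v k * splitN γ B k j = 0 := by nlinarith
  have h2 : ∑ k, v k * splitM γ B k j = 0 := by nlinarith
  have h3 := (Finset.sum_eq_zero_iff_of_nonneg hN).1 h1 i (Finset.mem_univ i)
  have h4 := (Finset.sum_eq_zero_iff_of_nonpos hM).1 h2 i (Finset.mem_univ i)
  rw [← splitM_sub_splitN γ B, Matrix.sub_apply, (mul_eq_zero.1 h3).resolve_left hi.ne',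
    (mul_eq_zero.1 h4).resolve_left hi.ne', sub_zero]

/-- The support of a left vector with `v N = l v M`, `0 < l`, is not a singleton. -/
lemma exists_ne_pos_of_left_vector (hB : IsLMatrix B) {l : ℝ} (hl : 0 < l) {v : Fin n → ℝ}
    (hv : ∀ i, 0 ≤ v i) (h : v ᵥ* splitN γ B = l • (v ᵥ* splitM γ B)) {k : Fin n}
    (hk : 0 < v k) : ∃ i, i ≠ k ∧ 0 < v i := by
  by_contra! hne
  have h0 : ∀ i, i ≠ k → v i = 0 := fun i hi => le_antisymm (hne i hi) (hv i)
  have hk' : ∑ i, v i * splitN γ B i k = l * ∑ i, v i * splitM γ B i k := congrFun h k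
  -- With support `{k}`, coordinate `k` reads `0 = l v_k B_kk`, because `N` has zero diagonal.
  rw [Finset.sum_eq_single k (fun i _ hi => by rw [h0 i hi, zero_mul]) (by simp),
    Finset.sum_eq_single k (fun i _ hi => by rw [h0 i hi, zero_mul]) (by simp),
    splitN_apply_self, splitM_apply_self, mul_zero] at hk'
  exact (mul_pos hl (mul_pos hk (hB.2 k))).ne hk'

end Splitting

-- Diagonal and triangular parts of sums and products.

section Parts

variable (B C : Matrix (Fin n) (Fin n) ℝ)

lemma diagPart_add : diagPart (B + C) = diagPart B + diagPart C := by
  ext i j; simp only [diagPart, Matrix.of_apply, Matrix.add_apply]; split_ifs <;> simp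

lemma lowPart_add : lowPart (B + C) = lowPart B + lowPart C := by
  ext i j; simp only [lowPart, Matrix.of_apply, Matrix.add_apply]; split_ifs <;> simp

lemma diagPart_one : diagPart (1 : Matrix (Fin n) (Fin n) ℝ) = 1 := by
  ext i j; simp only [diagPart, Matrix.of_apply, Matrix.one_apply]; split_ifs <;> simp

lemma lowPart_one : lowPart (1 : Matrix (Fin n) (Fin n) ℝ) = 0 := by
  ext i j
  simp only [lowPart, Matrix.of_apply, Matrix.one_apply, Matrix.zero_apply, ite_eq_right_iff]
  exact fun h h' => absurd h' h.ne'

lemma diagPart_lowPart : diagPart (lowPart B) = 0 := by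
  ext i j; simp only [diagPart, lowPart, Matrix.of_apply, Matrix.zero_apply]
  split_ifs with h1 h2
  · exact absurd h1 h2.ne'
  all_goals rfl

lemma diagPart_upPart : diagPart (upPart B) = 0 := by
  ext i j; simp only [diagPart, upPart, Matrix.of_apply, Matrix.zero_apply]
  split_ifs with h1 h2
  · exact absurd h1 h2.ne
  all_goals rfl

lemma lowPart_lowPart : lowPart (lowPart B) = lowPart B := by
  ext i j; simp only [lowPart, Matrix.of_apply]; split_ifs <;> rfl

lemma lowPart_upPart : lowPart (upPart B) = 0 := by
  ext i j; simp only [lowPart, upPart, Matrix.of_apply, Matrix.zero_apply]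
  split_ifs with h1 h2
  · exact absurd h1 h2.not_gt
  all_goals rfl

lemma lowPart_mul_lowPart_apply {i j : Fin n} (h : i ≤ j) : (lowPart B * lowPart C) i j = 0 := by
  rw [Matrix.mul_apply]
  refine Finset.sum_eq_zero fun k _ => ?_
  simp only [lowPart, Matrix.of_apply]
  split_ifs with h1 h2
  · exact absurd (h2.trans h1) h.not_gt
  all_goals simp

lemma upPart_mul_upPart_apply {i j : Fin n} (h : j ≤ i) : (upPart B * upPart C) i j = 0 := by
  rw [Matrix.mul_apply]
  refine Finset.sum_eq_zero fun k _ => ?_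
  simp only [upPart, Matrix.of_apply]
  split_ifs with h1 h2
  · exact absurd (h1.trans h2) h.not_gt
  all_goals simp

lemma diagPart_lowPart_mul_lowPart : diagPart (lowPart B * lowPart C) = 0 := by
  ext i j; simp only [diagPart, Matrix.of_apply, Matrix.zero_apply, ite_eq_right_iff]
  exact fun h => lowPart_mul_lowPart_apply B C h.le

lemma diagPart_upPart_mul_upPart : diagPart (upPart B * upPart C) = 0 := by
  ext i j; simp only [diagPart, Matrix.of_apply, Matrix.zero_apply, ite_eq_right_iff]
  exact fun h => upPart_mul_upPart_apply B C h.ge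

lemma lowPart_lowPart_mul_lowPart : lowPart (lowPart B * lowPart C) = lowPart B * lowPart C := by
  ext i j
  rw [lowPart, Matrix.of_apply, ite_eq_left_iff]
  exact fun h => (lowPart_mul_lowPart_apply B C (not_lt.1 h)).symm

lemma lowPart_upPart_mul_upPart : lowPart (upPart B * upPart C) = 0 := by
  ext i j; rw [lowPart, Matrix.of_apply, Matrix.zero_apply, ite_eq_right_iff]
  exact fun h => upPart_mul_upPart_apply B C h.le

lemma diagPart_neg : diagPart (-B) = -diagPart B := by
  ext i j; simp only [diagPart, Matrix.of_apply, Matrix.neg_apply]; split_ifs <;> simp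

lemma lowPart_neg : lowPart (-B) = -lowPart B := by
  ext i j; simp only [lowPart, Matrix.of_apply, Matrix.neg_apply]; split_ifs <;> simp

lemma eq_diagPart_add : B = diagPart B + lowPart B + upPart B := by
  ext i j
  simp only [diagPart, lowPart, upPart, Matrix.of_apply, Matrix.add_apply]
  rcases lt_trichotomy i j with h | rfl | h
  · simp [h, h.ne, h.not_gt]
  · simp
  · simp [h, h.ne', h.not_gt]

variable {B C}

lemma diagPart_nonneg (h : ∀ i j, 0 ≤ B i j) (i j : Fin n) : 0 ≤ diagPart B i j := by
  simp only [diagPart, Matrix.of_apply]; split_ifs <;> simp [h]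

lemma lowPart_nonneg (h : ∀ i j, 0 ≤ B i j) (i j : Fin n) : 0 ≤ lowPart B i j := by
  simp only [lowPart, Matrix.of_apply]; split_ifs <;> simp [h]

lemma upPart_nonneg (h : ∀ i j, 0 ≤ B i j) (i j : Fin n) : 0 ≤ upPart B i j := by
  simp only [upPart, Matrix.of_apply]; split_ifs <;> simp [h]

lemma matL_nonneg (h : IsLMatrix B) (i j : Fin n) : 0 ≤ matL B i j := by
  simp only [matL, lowPart, Matrix.neg_apply, Matrix.of_apply]
  split_ifs with hij
  · simpa using h.1 i j hij.ne'
  · simp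

lemma matU_nonneg (h : IsLMatrix B) (i j : Fin n) : 0 ≤ matU B i j := by
  simp only [matU, upPart, Matrix.neg_apply, Matrix.of_apply]
  split_ifs with hij
  · simpa using h.1 i j hij.ne
  · simp

lemma mul_entry_nonneg (hB : ∀ i j, 0 ≤ B i j) (hC : ∀ i j, 0 ≤ C i j) (i j : Fin n) :
    0 ≤ (B * C) i j := by
  rw [Matrix.mul_apply]
  exact Finset.sum_nonneg fun k _ => mul_nonneg (hB i k) (hC k j)

lemma mul_entry_pos (hB : ∀ i j, 0 ≤ B i j) (hC : ∀ i j, 0 ≤ C i j) {i k j : Fin n}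
    (hik : 0 < B i k) (hkj : 0 < C k j) : 0 < (B * C) i j := by
  rw [Matrix.mul_apply]
  exact Finset.sum_pos' (fun k _ => mul_nonneg (hB i k) (hC k j))
    ⟨k, Finset.mem_univ k, mul_pos hik hkj⟩

end Parts

-- The gain from preconditioning and the rows where it is strict.

section Gain

variable {A Q : Matrix (Fin n) (Fin n) ℝ} {γ ω : ℝ}

lemma IsAdmissibleQ.nonneg (hQ : IsAdmissibleQ Q) (i j : Fin n) : 0 ≤ Q i j := by
  by_cases h : i = j
  · rw [h, hQ.diag_eq_zero]
  · exact hQ.offDiag_nonneg i j h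

lemma IsAdmissibleQ.exists_pos (hQ : IsAdmissibleQ Q) : ∃ i j, 0 < Q i j := by
  by_contra! h
  refine hQ.sum_ne_zero (Finset.sum_eq_zero fun i _ => Finset.sum_eq_zero fun j _ => ?_)
  exact le_antisymm (h i j) (hQ.nonneg i j)

lemma IsAdmissibleQ.ne_of_pos (hQ : IsAdmissibleQ Q) {i j : Fin n} (h : 0 < Q i j) : i ≠ j := by
  rintro rfl
  exact h.ne' (hQ.diag_eq_zero i)

/-- Excludes order one, where irreducibility is vacuous and the Perron argument would give no
positive `l`. -/
lemma IsAdmissibleQ.one_lt (hQ : IsAdmissibleQ Q) : 1 < n := by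
  obtain ⟨i, j, h⟩ := hQ.exists_pos
  have := hQ.ne_of_pos h
  rw [Ne, Fin.ext_iff] at this
  omega

/-- The part `E₁ + E₂ + γ F₁ + γ F₂ + (1 - γ) Q⁽ˡ⁾` of `Δ(γ)`. -/
noncomputable def gain (A Q : Matrix (Fin n) (Fin n) ℝ) (γ : ℝ) : Matrix (Fin n) (Fin n) ℝ :=
  (diagPart (lowPart Q * matU A) + diagPart (upPart Q * matL A))
    + γ • lowPart (lowPart Q * matU A)
    + γ • lowPart (upPart Q * matL A)
    + (1 - γ) • lowPart Q

/-- The effect of the preconditioner on the lower triangular part of the splitting. -/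
lemma precond_mul_splitM (hdiag : ∀ i, A i i = 1) (hQ : IsAdmissibleQ Q) (γ : ℝ) :
    (1 + Q) * splitM γ A =
      splitM γ (precond Q A) + gain A Q γ + upPart Q * splitM γ A := by
  have hA1 : diagPart A = 1 := by
    ext i j
    simp only [diagPart, Matrix.of_apply, Matrix.one_apply]
    split_ifs with h
    · rw [← h, hdiag]
    · rfl
  have hQ0 : diagPart Q = 0 := by
    ext i j
    simp only [diagPart, Matrix.of_apply, Matrix.zero_apply, ite_eq_right_iff]
    rintro rfl
    exact hQ.diag_eq_zero i
  have hA : A = 1 + lowPart A + upPart A := by rw [← hA1]; exact eq_diagPart_add A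
  have hQ' : Q = lowPart Q + upPart Q := by
    conv_lhs => rw [eq_diagPart_add Q, hQ0, zero_add]
  have hP : precond Q A = 1 + lowPart A + upPart A + (lowPart Q + upPart Q
      + lowPart Q * lowPart A + lowPart Q * upPart A + upPart Q * lowPart A
      + upPart Q * upPart A) := by
    conv_lhs => rw [precond, hA, hQ']
    noncomm_ring
  have hd : diagPart (precond Q A) =
      1 + diagPart (lowPart Q * upPart A) + diagPart (upPart Q * lowPart A) := by
    rw [hP]
    simp only [diagPart_add, diagPart_one, diagPart_lowPart, diagPart_upPart,
      diagPart_lowPart_mul_lowPart, diagPart_upPart_mul_upPart]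
    abel
  have hl : lowPart (precond Q A) = lowPart A + lowPart Q + lowPart Q * lowPart A
      + lowPart (lowPart Q * upPart A) + lowPart (upPart Q * lowPart A) := by
    rw [hP]
    simp only [lowPart_add, lowPart_one, lowPart_lowPart, lowPart_upPart,
      lowPart_lowPart_mul_lowPart, lowPart_upPart_mul_upPart]
    abel
  have hPM : (1 + Q) * splitM γ A = splitM γ A + lowPart Q * splitM γ A
      + upPart Q * splitM γ A := by
    conv_lhs => rw [hQ']
    noncomm_ring
  -- The term `Q⁽ᵘ⁾M` is common to both sides and is left unexpanded: applied to the Perron vector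
  -- it becomes the nonnegative `l⁻¹Q⁽ᵘ⁾N`.
  rw [hPM]
  congr 1
  simp only [splitM, gain, matL, matU, hd, hl, hA1, Matrix.mul_neg, diagPart_neg, lowPart_neg,
    Matrix.mul_sub, Matrix.mul_smul, Matrix.mul_one]
  module

lemma gain_nonneg (hA : IsLMatrix A) (hQ : IsAdmissibleQ Q) (hγ0 : 0 ≤ γ) (hγ1 : γ ≤ 1)
    (i j : Fin n) : 0 ≤ gain A Q γ i j := by
  have h1 := mul_entry_nonneg (lowPart_nonneg hQ.nonneg) (matU_nonneg hA)
  have h2 := mul_entry_nonneg (upPart_nonneg hQ.nonneg) (matL_nonneg hA)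
  have h3 := diagPart_nonneg h1 i j
  have h4 := diagPart_nonneg h2 i j
  have h5 := lowPart_nonneg h1 i j
  have h6 := lowPart_nonneg h2 i j
  have h7 := lowPart_nonneg hQ.nonneg i j
  have h8 := sub_nonneg.2 hγ1
  simp only [gain, Matrix.add_apply, Matrix.smul_apply, smul_eq_mul]
  positivity

/-- Rows in which the preconditioner has a strict effect. -/
def ActiveRow (A Q : Matrix (Fin n) (Fin n) ℝ) (γ : ℝ) (i : Fin n) : Prop :=
  ∃ j, 0 < gain A Q γ i j ∨ 0 < (upPart Q * splitN γ A) i j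

/-- For `γ < 1`, an entry of `Q` below the diagonal contributes through `(1 - γ)Q⁽ˡ⁾`. One above it
meets a nonzero off-diagonal entry in row `j` of `A`, which `N` sees on either side of the diagonal.
-/
lemma activeRow_of_pos (hA : IsLMatrix A) (hAirr : IsIrred A) (hQ : IsAdmissibleQ Q)
    (hγ0 : 0 ≤ γ) (hγ1 : γ < 1) {i j : Fin n} (h : 0 < Q i j) : ActiveRow A Q γ i := by
  rcases lt_or_gt_of_ne (hQ.ne_of_pos h) with hij | hij
  · obtain ⟨k, hk, hk0⟩ := hAirr.exists_ne_zero hQ.one_lt j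
    refine ⟨k, Or.inr (mul_entry_pos (upPart_nonneg hQ.nonneg) (splitN_nonneg hA hγ1.le) (k := j)
      (by simpa [upPart, hij] using h) ?_)⟩
    have hneg := lt_of_le_of_ne (hA.1 j k hk.symm) hk0
    rcases lt_or_gt_of_ne hk with hkj | hkj
    · rw [splitN_apply_of_lt hkj]
      nlinarith
    · rw [splitN_apply_of_gt hkj]
      linarith
  · refine ⟨j, Or.inl ?_⟩
    have h1 := mul_entry_nonneg (lowPart_nonneg hQ.nonneg) (matU_nonneg hA)
    have h2 := mul_entry_nonneg (upPart_nonneg hQ.nonneg) (matL_nonneg hA)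
    have h3 := diagPart_nonneg h1 i j
    have h4 := diagPart_nonneg h2 i j
    have h5 := lowPart_nonneg h1 i j
    have h6 := lowPart_nonneg h2 i j
    have h7 : 0 < lowPart Q i j := by simpa [lowPart, hij] using h
    have h8 := sub_pos.2 hγ1
    simp only [gain, Matrix.add_apply, Matrix.smul_apply, smul_eq_mul]
    positivity

/-- At `γ = 1` one has `N = U`, so `Δ` is exactly the sum of the two matrices defining activity. -/
lemma activeRow_one_of_Delta_pos {i j : Fin n} (h : 0 < Delta A Q 1 i j) :
    ActiveRow A Q 1 i := by
  refine ⟨j, ?_⟩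
  have hD : Delta A Q 1 i j = gain A Q 1 i j + (upPart Q * splitN 1 A) i j := by
    simp [Delta, gain, splitN]
  rw [hD] at h
  by_contra! h'
  linarith [h'.1, h'.2]

/-- A negative product `q_{i,k} a_{k,j}` in one of the relevant positions makes row `i` active. -/
lemma activeRow_one_of_mul_neg (hA : IsLMatrix A) (hQ : IsAdmissibleQ Q) {i k j : Fin n}
    (h : Q i k * A k j < 0) (hpos : (k < j ∧ j ≤ i) ∨ (i < k ∧ (j ≤ i ∨ k < j))) :
    ActiveRow A Q 1 i := by
  have hq : 0 < Q i k := lt_of_le_of_ne (hQ.nonneg i k) fun h0 => by simp [← h0] at h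
  have ha : A k j < 0 := by
    by_contra! h0
    exact h.not_ge (mul_nonneg hq.le h0)
  have h1 := mul_entry_nonneg (lowPart_nonneg hQ.nonneg) (matU_nonneg hA)
  have h2 := mul_entry_nonneg (upPart_nonneg hQ.nonneg) (matL_nonneg hA)
  have h3 := diagPart_nonneg h1 i j
  have h4 := diagPart_nonneg h2 i j
  have h5 := lowPart_nonneg h1 i j
  have h6 := lowPart_nonneg h2 i j
  -- The three positions correspond to `Q⁽ˡ⁾U`, `Q⁽ᵘ⁾L` (both on or below the diagonal) and `Q⁽ᵘ⁾U`.
  rcases hpos with ⟨hkj, hji⟩ | ⟨hik, hji | hkj⟩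
  · have hp : 0 < (lowPart Q * matU A) i j :=
      mul_entry_pos (lowPart_nonneg hQ.nonneg) (matU_nonneg hA) (k := k)
        (by simpa [lowPart, hkj.trans_le hji] using hq) (by simpa [matU, upPart, hkj] using ha)
    refine ⟨j, Or.inl ?_⟩
    simp only [gain, Matrix.add_apply, Matrix.smul_apply, smul_eq_mul, one_mul, sub_self,
      zero_mul, add_zero]
    rcases hji.eq_or_lt with rfl | hlt
    · have : 0 < diagPart (lowPart Q * matU A) j j := by simpa [diagPart] using hp
      positivity
    · have : 0 < lowPart (lowPart Q * matU A) i j := by simpa [lowPart, hlt] using hp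
      positivity
  · have hp : 0 < (upPart Q * matL A) i j :=
      mul_entry_pos (upPart_nonneg hQ.nonneg) (matL_nonneg hA) (k := k)
        (by simpa [upPart, hik] using hq) (by simpa [matL, lowPart, hji.trans_lt hik] using ha)
    refine ⟨j, Or.inl ?_⟩
    simp only [gain, Matrix.add_apply, Matrix.smul_apply, smul_eq_mul, one_mul, sub_self,
      zero_mul, add_zero]
    rcases hji.eq_or_lt with rfl | hlt
    · have : 0 < diagPart (upPart Q * matL A) j j := by simpa [diagPart] using hp
      positivity
    · have : 0 < lowPart (upPart Q * matL A) i j := by simpa [lowPart, hlt] using hp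
      positivity
  · refine ⟨j, Or.inr (mul_entry_pos (upPart_nonneg hQ.nonneg) (splitN_nonneg hA le_rfl) (k := k)
      (by simpa [upPart, hik] using hq) ?_)⟩
    rw [splitN_apply_of_gt hkj]
    linarith

lemma ne_of_Q_mul_neg (hQ : IsAdmissibleQ Q) {i k : Fin n} {a : ℝ} (h : Q i k * a < 0) :
    k ≠ i := by
  rintro rfl
  simp [hQ.diag_eq_zero] at h

/-- Row `i + 1` of `A` has a nonzero entry in some column `j ≠ i + 1`; since no index lies between
`i` and `i + 1`, either `j ≤ i` or `j > i + 1`, and both positions count. -/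
lemma activeRow_one_of_superdiag (hA : IsLMatrix A) (hAirr : IsIrred A) (hQ : IsAdmissibleQ Q)
    {i i' : Fin n} (hi' : (i' : ℕ) = i + 1) (h : 0 < Q i i') : ActiveRow A Q 1 i := by
  obtain ⟨j, hj, hj0⟩ := hAirr.exists_ne_zero hQ.one_lt i'
  have hneg := lt_of_le_of_ne (hA.1 i' j hj.symm) hj0
  refine activeRow_one_of_mul_neg hA hQ (mul_neg_of_pos_of_neg h hneg) (Or.inr ⟨?_, ?_⟩)
  · rw [Fin.lt_def]; omega
  · rw [Ne, Fin.ext_iff] at hj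
    rw [Fin.lt_def, Fin.le_def]; omega

/-- The zero diagonal of `Q` excludes `j = i`; if `j < i` then `j + 1 ≤ i`, and if `j > i` the
product belongs to `Q⁽ᵘ⁾U`. -/
lemma activeRow_one_of_mul_superdiag_neg (hA : IsLMatrix A) (hQ : IsAdmissibleQ Q)
    {i j j' : Fin n} (hj' : (j' : ℕ) = j + 1) (h : Q i j * A j j' < 0) : ActiveRow A Q 1 i := by
  refine activeRow_one_of_mul_neg hA hQ h ?_
  have := ne_of_Q_mul_neg hQ h
  rw [Ne, Fin.ext_iff] at this
  simp only [Fin.lt_def, Fin.le_def]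
  omega

lemma activeRow_one_of_mul_diag_neg (hA : IsLMatrix A) (hQ : IsAdmissibleQ Q)
    {i j : Fin n} (h : Q i j * A j i < 0) : ActiveRow A Q 1 i := by
  refine activeRow_one_of_mul_neg hA hQ h ?_
  rcases lt_or_gt_of_ne (ne_of_Q_mul_neg hQ h) with h' | h'
  · exact Or.inl ⟨h', le_rfl⟩
  · exact Or.inr ⟨h', Or.inl le_rfl⟩

variable [NeZero n]

lemma le_lastIdx (i : Fin n) : i ≤ lastIdx := by
  simp only [lastIdx, Fin.le_def]
  omega

lemma activeRow_one_of_mul_last_neg (hA : IsLMatrix A) (hQ : IsAdmissibleQ Q)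
    {i j : Fin n} (hji : j ≤ i) (h : Q i lastIdx * A lastIdx j < 0) : ActiveRow A Q 1 i :=
  activeRow_one_of_mul_neg hA hQ h
    (Or.inr ⟨lt_of_le_of_ne (le_lastIdx i) (ne_of_Q_mul_neg hQ h).symm, Or.inl hji⟩)

lemma activeRow_one_of_mul_first_column_neg (hA : IsLMatrix A) (hQ : IsAdmissibleQ Q)
    {i j : Fin n} (hij : i < j) (h : Q i j * A j 0 < 0) : ActiveRow A Q 1 i :=
  activeRow_one_of_mul_neg hA hQ h (Or.inr ⟨hij, Or.inl (Fin.zero_le _)⟩)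

/-- Any nonzero off-diagonal entry of the first row of `A` lies above the diagonal, and its column
never exceeds the last index. -/
lemma activeRow_one_of_corner (hA : IsLMatrix A) (hAirr : IsIrred A) (hQ : IsAdmissibleQ Q)
    (h : 0 < Q lastIdx 0) : ActiveRow A Q 1 lastIdx := by
  obtain ⟨j, hj, hj0⟩ := hAirr.exists_ne_zero hQ.one_lt 0
  have hneg := lt_of_le_of_ne (hA.1 0 j hj.symm) hj0
  exact activeRow_one_of_mul_neg hA hQ (mul_neg_of_pos_of_neg h hneg)
    (Or.inl ⟨Fin.pos_iff_ne_zero.2 hj, le_lastIdx j⟩)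

lemma RowCond7.activeRow (hA : IsLMatrix A) (hQ : IsAdmissibleQ Q) {i : Fin n}
    (h : RowCond7 A Q i) : ActiveRow A Q 1 i := by
  obtain ⟨j, hj, hji, h⟩ := h
  exact activeRow_one_of_mul_neg hA hQ h (Or.inl ⟨hj, hji⟩)

lemma RowCond.activeRow (hA : IsLMatrix A) (hAirr : IsIrred A) (hQ : IsAdmissibleQ Q) {i : Fin n}
    (h : RowCond A Q i) : ActiveRow A Q 1 i := by
  rcases h with ⟨j, h⟩ | ⟨i', hi', h⟩ | ⟨j, h⟩ | ⟨j, hji, h⟩ | ⟨j, hij, h⟩ | ⟨j, j', hj', h⟩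
  · exact activeRow_one_of_Delta_pos h
  · exact activeRow_one_of_superdiag hA hAirr hQ hi' h
  · exact activeRow_one_of_mul_diag_neg hA hQ h
  · exact activeRow_one_of_mul_last_neg hA hQ hji h
  · exact activeRow_one_of_mul_first_column_neg hA hQ hij h
  · exact activeRow_one_of_mul_superdiag_neg hA hQ hj' h

lemma GlobalCond.exists_activeRow (hA : IsLMatrix A) (hAirr : IsIrred A) (hQ : IsAdmissibleQ Q)
    (h : GlobalCond A Q) : ∃ i, ActiveRow A Q 1 i := by
  rcases h with ⟨i, j, h⟩ | h | ⟨k, k', hk', h⟩ | ⟨i, j, h⟩ | ⟨i, j, -, hji, h⟩ | ⟨i, j, hij, h⟩ |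
    ⟨i, j, j', hj', h⟩ | ⟨i, h⟩ | ⟨hcorner, hsuper⟩
  · exact ⟨i, activeRow_one_of_Delta_pos h⟩
  · exact ⟨_, activeRow_one_of_corner hA hAirr hQ h⟩
  · exact ⟨k, activeRow_one_of_superdiag hA hAirr hQ hk' h⟩
  · exact ⟨i, activeRow_one_of_mul_diag_neg hA hQ h⟩
  · exact ⟨i, activeRow_one_of_mul_last_neg hA hQ hji h⟩
  · exact ⟨i, activeRow_one_of_mul_first_column_neg hA hQ hij h⟩
  · exact ⟨i, activeRow_one_of_mul_superdiag_neg hA hQ hj' h⟩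
  · exact ⟨i, RowCond7.activeRow hA hQ h⟩
  -- Here any positive `Q i j` works: it meets the corner entry of `A` if `j` is last, and a
  -- superdiagonal entry otherwise.
  · obtain ⟨i, j, hij⟩ := hQ.exists_pos
    refine ⟨i, ?_⟩
    rcases (le_lastIdx j).eq_or_lt with rfl | hj
    · exact activeRow_one_of_mul_last_neg hA hQ (Fin.zero_le i) (mul_neg_of_pos_of_neg hij hcorner)
    · have hj1 : (j : ℕ) + 1 < n := by
        simp only [lastIdx, Fin.lt_def] at hj
        omega
      exact activeRow_one_of_mul_superdiag_neg hA hQ (j' := ⟨j + 1, hj1⟩) rfl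
        (mul_neg_of_pos_of_neg hij (hsuper j ⟨j + 1, hj1⟩ rfl))

/-- In the last row of `QA` the term `k = j` is `Q lastIdx j` by the unit diagonal of `A`, and the
term `k = lastIdx` drops out by the zero diagonal of `Q`. -/
lemma precond_lastIdx_apply (hQ : IsAdmissibleQ Q) (hdiag : ∀ i, A i i = 1) (j : Fin n) :
    precond Q A lastIdx j = lastRowExpr A Q j := by
  rw [precond, Matrix.add_mul, Matrix.one_mul, Matrix.add_apply, Matrix.mul_apply, lastRowExpr,
    add_assoc]
  congr 1
  rw [← Finset.add_sum_erase _ _ (Finset.mem_univ j), hdiag, mul_one]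
  congr 1
  symm
  refine Finset.sum_subset (fun k hk => ?_) fun k hk hk' => ?_
  · simp only [Finset.mem_filter, Finset.mem_univ, true_and] at hk
    simp [hk.2]
  · simp only [Finset.mem_erase, Finset.mem_univ, and_true] at hk
    simp only [Finset.mem_filter, Finset.mem_univ, true_and, not_and_or, not_lt, hk, ne_eq,
      not_false_eq_true, not_true_eq_false, or_false] at hk'
    rw [le_antisymm (le_lastIdx k) hk', hQ.diag_eq_zero, zero_mul]

end Gain

-- Comparison of the two spectral radii.

section Comparison

variable {A Q : Matrix (Fin n) (Fin n) ℝ} {γ ω : ℝ}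

lemma strictTrichotomy_of_mul_eq {r₁ r a b : ℝ} (h₁ : 0 ≤ r₁) (hr : 0 ≤ r) (ha : 0 < a)
    (hb : 0 < b) (h : (r₁ - r) * a = (r - 1) * b) :
    StrictTrichotomy (ENNReal.ofReal r₁) (ENNReal.ofReal r) := by
  refine ⟨?_, fun h => h.1.2.ne h.2.2, fun h => h.1.2.not_gt h.2.2, fun h => h.2.2.ne' h.1.2⟩
  rcases lt_trichotomy r 1 with hr1 | rfl | hr1
  · have hlt : r₁ < r := by
      by_contra! h'
      nlinarith
    exact Or.inl ⟨(ENNReal.ofReal_lt_ofReal_iff_of_nonneg h₁).2 hlt, by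
      rwa [← ENNReal.ofReal_one, ENNReal.ofReal_lt_ofReal_iff_of_nonneg hr]⟩
  · have heq : r₁ = 1 := by
      have : (r₁ - 1) * a = 0 := by rw [h]; ring
      rcases mul_eq_zero.1 this with h' | h'
      · linarith
      · exact absurd h' ha.ne'
    exact Or.inr (Or.inl ⟨by rw [heq], ENNReal.ofReal_one⟩)
  · have hlt : r < r₁ := by
      by_contra! h'
      nlinarith
    exact Or.inr (Or.inr ⟨(ENNReal.ofReal_lt_ofReal_iff_of_nonneg hr).2 hlt, by
      rwa [← ENNReal.ofReal_one, ENNReal.ofReal_lt_ofReal_iff_of_nonneg zero_le_one]⟩)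

/-- If every nonnegative nonzero left vector of the preconditioned splitting has an active row in
its support, the strict trichotomy holds. -/
theorem strictTrichotomy_of_activeRow [NeZero n] (hω0 : 0 < ω) (hω1 : ω ≤ 1) (hγ0 : 0 ≤ γ)
    (hγ1 : γ ≤ 1) (hdiag : ∀ i, A i i = 1) (hA : IsLMatrix A) (hAirr : IsIrred A)
    (hQ : IsAdmissibleQ Q) (hPA : IsLMatrix (precond Q A))
    (hact : ∀ (v : Fin n → ℝ), (∀ i, 0 ≤ v i) → v ≠ 0 →
      (∀ i j, 0 < v i → v j = 0 → precond Q A i j = 0) →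
      (∀ k, 0 < v k → ∃ i, i ≠ k ∧ 0 < v i) → ∃ i, 0 < v i ∧ ActiveRow A Q γ i) :
    StrictTrichotomy (rho (aor γ ω (precond Q A))) (rho (aor γ ω A)) := by
  obtain ⟨l, x, hl, hrho, hx, hNx⟩ := exists_right_vector hQ.one_lt hA hAirr hγ0 hγ1 hω0 hω1
  obtain ⟨l₁, v, hl₁, hrho₁, hv, hw, hw0, hvN⟩ := exists_left_vector hPA hγ0 hγ1 hω0 hω1
  set M := splitM γ A
  set M₁ := splitM γ (precond Q A)
  have hx0 : ∀ i, 0 ≤ x i := fun i => (hx i).le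
  have hv0 : v ≠ 0 := by
    rintro rfl
    exact hw0 (Matrix.zero_vecMul _)
  have hMx : M *ᵥ x = l⁻¹ • (splitN γ A *ᵥ x) := by
    rw [hNx, smul_smul, inv_mul_cancel₀ hl.ne', one_smul]
  set y := gain A Q γ *ᵥ x + l⁻¹ • ((upPart Q * splitN γ A) *ᵥ x) with hy
  have hPMx : ((1 + Q) * M) *ᵥ x = M₁ *ᵥ x + y := by
    rw [precond_mul_splitM hdiag hQ, Matrix.add_mulVec, Matrix.add_mulVec, ← Matrix.mulVec_mulVec,
      hMx, Matrix.mulVec_smul, Matrix.mulVec_mulVec, add_assoc]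
  have hG := gain_nonneg hA hQ hγ0 hγ1
  have hUN := mul_entry_nonneg (upPart_nonneg hQ.nonneg) (splitN_nonneg hA hγ1)
  have hl' : 0 < l⁻¹ := inv_pos.2 hl
  have hyi : ∀ i, y i = (gain A Q γ *ᵥ x) i + l⁻¹ * ((upPart Q * splitN γ A) *ᵥ x) i :=
    fun i => rfl
  have hy0 : ∀ i, 0 ≤ y i := fun i => by
    have h1 := mulVec_nonneg_of_nonneg hG hx0 i
    have h2 := mulVec_nonneg_of_nonneg hUN hx0 i
    rw [hyi]
    positivity
  have hypos : ∀ i, ActiveRow A Q γ i → 0 < y i := by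
    rintro i ⟨j, h | h⟩ <;> rw [hyi]
    · exact add_pos_of_pos_of_nonneg (mulVec_pos_of_entry_pos hG hx0 h (hx j))
        (mul_nonneg hl'.le (mulVec_nonneg_of_nonneg hUN hx0 i))
    · exact add_pos_of_nonneg_of_pos (mulVec_nonneg_of_nonneg hG hx0 i)
        (mul_pos hl' (mulVec_pos_of_entry_pos hUN hx0 h (hx j)))
  have ha : 0 < (v ᵥ* M₁) ⬝ᵥ x := by
    obtain ⟨k, hk⟩ := exists_pos_of_nonneg_of_ne_zero hw hw0
    exact Finset.sum_pos' (fun i _ => mul_nonneg (hw i) (hx0 i))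
      ⟨k, Finset.mem_univ k, mul_pos hk (hx k)⟩
  have hb0 : 0 ≤ v ⬝ᵥ y := Finset.sum_nonneg fun i _ => mul_nonneg (hv i) (hy0 i)
  have hAx : A *ᵥ x = (1 - l) • (M *ᵥ x) := by
    conv_lhs => rw [← splitM_sub_splitN γ A]
    rw [Matrix.sub_mulVec, hNx, sub_smul, one_smul]
  have hvP : v ᵥ* precond Q A = (1 - l₁) • (v ᵥ* M₁) := by
    conv_lhs => rw [← splitM_sub_splitN γ (precond Q A)]
    rw [Matrix.vecMul_sub, hvN, sub_smul, one_smul]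
  -- Evaluate `v(PA)x` once through the left vector of `PA` and once through the right vector of
  -- `A`.
  have hcore : (l₁ - l) * ((v ᵥ* M₁) ⬝ᵥ x) = (l - 1) * (v ⬝ᵥ y) := by
    have h1 : (v ᵥ* precond Q A) ⬝ᵥ x = (1 - l₁) * ((v ᵥ* M₁) ⬝ᵥ x) := by
      rw [hvP, smul_dotProduct, smul_eq_mul]
    have h2 : (v ᵥ* precond Q A) ⬝ᵥ x = (1 - l) * ((v ᵥ* M₁) ⬝ᵥ x + v ⬝ᵥ y) := by
      rw [← Matrix.dotProduct_mulVec, precond, ← Matrix.mulVec_mulVec, hAx, Matrix.mulVec_smul,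
        Matrix.mulVec_mulVec, hPMx, dotProduct_smul, dotProduct_add, Matrix.dotProduct_mulVec,
        smul_eq_mul]
    linear_combination h1 - h2
  have hb : 0 < v ⬝ᵥ y := by
    refine lt_of_le_of_ne hb0 fun hb => ?_
    -- Vanishing of `v · y` forces `l₁ = l`; the positivity of `l₁` thus gained is what the support
    -- lemmas need.
    rw [← hb, mul_zero, mul_eq_zero, or_iff_left ha.ne', sub_eq_zero] at hcore
    have hl1 : 0 < l₁ := hcore ▸ hl
    obtain ⟨i, hi, hai⟩ := hact v hv hv0
      (fun i j hi hj => apply_eq_zero_of_left_vector hPA hγ0 hγ1 hl1 hv hvN hi hj)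
      (fun k hk => exists_ne_pos_of_left_vector hPA hl1 hv hvN hk)
    refine hb.not_lt (Finset.sum_pos' (fun i _ => mul_nonneg (hv i) (hy0 i))
      ⟨i, Finset.mem_univ i, mul_pos hi (hypos i hai)⟩)
  rw [hrho, hrho₁]
  have hr : 0 ≤ 1 - ω + ω * l := by
    have := sub_nonneg.2 hω1
    positivity
  exact strictTrichotomy_of_mul_eq hl₁ hr ha hb (by linear_combination ω * hcore)

lemma pos_of_isIrred_of_closed {B : Matrix (Fin n) (Fin n) ℝ} (hB : IsIrred B) {v : Fin n → ℝ}
    (hv : ∀ i, 0 ≤ v i) (hv0 : v ≠ 0) (hcl : ∀ i j, 0 < v i → v j = 0 → B i j = 0) (i : Fin n) :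
    0 < v i := by
  obtain ⟨k, hk⟩ := exists_pos_of_nonneg_of_ne_zero hv hv0
  have huniv := hB.eq_univ_of_closed (T := Finset.univ.filter fun k => 0 < v k)
    ⟨k, by simpa using hk⟩ (fun i hi j hj => by
      simp only [Finset.mem_filter, Finset.mem_univ, true_and] at hi hj
      exact hcl i j hi (le_antisymm (not_lt.1 hj) (hv j)))
  have hi : i ∈ Finset.univ.filter fun k => 0 < v k := by rw [huniv]; exact Finset.mem_univ _
  exact (Finset.mem_filter.1 hi).2

/-- A nonnegative nonzero vector whose support has at least two elements is positive at an active
row as soon as the conditions on the rows for `γ = 1` hold. -/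
lemma exists_activeRow_of_rowCond [NeZero n] (hdiag : ∀ i, A i i = 1) (hA : IsLMatrix A)
    (hAirr : IsIrred A) (hQ : IsAdmissibleQ Q)
    (hrow : ∀ i, 0 < i → i < lastIdx → RowCond A Q i ∨ RowCond7 A Q i) (hlast : LastRowCond A Q)
    {v : Fin n → ℝ} (hv : ∀ i, 0 ≤ v i) (hv0 : v ≠ 0)
    (hcl : ∀ i j, 0 < v i → v j = 0 → precond Q A i j = 0)
    (hsupp : ∀ k, 0 < v k → ∃ i, i ≠ k ∧ 0 < v i) : ∃ i, 0 < v i ∧ ActiveRow A Q 1 i := by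
  by_contra! hne
  have hmid : ∀ i, 0 < v i → i = 0 ∨ i = lastIdx := by
    intro i hi
    by_contra! h
    refine hne i hi ?_
    rcases hrow i (Fin.pos_iff_ne_zero.2 h.1) (lt_of_le_of_ne (le_lastIdx i) h.2) with h' | h'
    · exact h'.activeRow hA hAirr hQ
    · exact h'.activeRow hA hQ
  -- All middle rows are active, so a support of at least two elements avoiding active rows is
  -- exactly the first and last index.
  have hends : 0 < v 0 ∧ 0 < v lastIdx := by
    obtain ⟨k, hk⟩ := exists_pos_of_nonneg_of_ne_zero hv hv0
    obtain ⟨i, hik, hi⟩ := hsupp k hk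
    rcases hmid k hk with rfl | rfl <;> rcases hmid i hi with rfl | rfl
    · exact absurd rfl hik
    · exact ⟨hk, hi⟩
    · exact ⟨hi, hk⟩
    · exact absurd rfl hik
  rcases hlast with ⟨j, k, hkj, h⟩ | h | ⟨j, hj0, hjl, h⟩ | ⟨h, -⟩ | ⟨h, -⟩
  · exact hne _ hends.2 (activeRow_one_of_mul_neg hA hQ h (Or.inl ⟨hkj, le_lastIdx j⟩))
  · exact hne _ hends.2 (activeRow_one_of_corner hA hAirr hQ h)
  -- A nonzero entry of `PA` leads from the last row to a middle index, outside the support,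
  -- contradicting closedness.
  · rw [← precond_lastIdx_apply hQ hdiag j] at h
    refine h.ne (hcl _ _ hends.2 (le_antisymm (not_lt.1 fun hj => ?_) (hv j)))
    rcases hmid j hj with h' | h'
    · exact hj0.ne' h'
    · exact hjl.ne h'
  · exact hne _ hends.1 (h.activeRow hA hAirr hQ)
  · exact hne _ hends.1 (h.activeRow hA hAirr hQ)

end Comparison

end PrecondAOR

-- The trichotomy under each of the four conditions.

theorem theorem3p3 (n : ℕ) [NeZero n] (A Q : Matrix (Fin n) (Fin n) ℝ) (γ ω : ℝ)
    (hω0 : 0 < ω) (hω1 : ω ≤ 1) (hγ0 : 0 ≤ γ) (hγ1 : γ ≤ 1)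
    (hdiag : ∀ i, A i i = 1) (hA : IsLMatrix A) (hAirr : IsIrred A)
    (hQ : IsAdmissibleQ Q) (hPA : IsLMatrix (precond Q A))
    (hcond :
      (γ < 1 ∧ IsIrred (precond Q A)) ∨
      (γ = 1 ∧ IsIrred (precond Q A) ∧ GlobalCond A Q) ∨
      (γ < 1 ∧ ∀ i, i < lastIdx → ∃ j, 0 < Q i j) ∨
      (γ = 1 ∧ (∀ i, 0 < i → i < lastIdx → RowCond A Q i ∨ RowCond7 A Q i) ∧
        LastRowCond A Q)) :
    StrictTrichotomy (rho (aor γ ω (precond Q A))) (rho (aor γ ω A)) := by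
  refine strictTrichotomy_of_activeRow hω0 hω1 hγ0 hγ1 hdiag hA hAirr hQ hPA
    fun v hv hv0 hcl hsupp => ?_
  rcases hcond with ⟨hγ, hirr⟩ | ⟨rfl, hirr, hglobal⟩ | ⟨hγ, hrow⟩ | ⟨rfl, hrow, hlast⟩
  · obtain ⟨i, j, hij⟩ := hQ.exists_pos
    exact ⟨i, pos_of_isIrred_of_closed hirr hv hv0 hcl i,
      activeRow_of_pos hA hAirr hQ hγ0 hγ hij⟩
  · obtain ⟨i, hi⟩ := hglobal.exists_activeRow hA hAirr hQ
    exact ⟨i, pos_of_isIrred_of_closed hirr hv hv0 hcl i, hi⟩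
  -- A support with at least two elements contains an index other than the last, and every such row
  -- is active.
  · have hex : ∃ i, i < lastIdx ∧ 0 < v i := by
      obtain ⟨k, hk⟩ := exists_pos_of_nonneg_of_ne_zero hv hv0
      rcases (le_lastIdx k).eq_or_lt with rfl | hlt
      · obtain ⟨i, hik, hi⟩ := hsupp _ hk
        exact ⟨i, lt_of_le_of_ne (le_lastIdx i) hik, hi⟩
      · exact ⟨k, hlt, hk⟩
    obtain ⟨i, hlt, hi⟩ := hex
    obtain ⟨j, hij⟩ := hrow i hlt
    exact ⟨i, hi, activeRow_of_pos hA hAirr hQ hγ0 hγ hij⟩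
  · exact exists_activeRow_of_rowCond hdiag hA hAirr hQ hrow hlast hv hv0 hcl hsupp
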